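/- Let $G$ be a finite group, let $K,H$ be subgroups of $G$ and let $g\in G$. Write $K^f=fKf^{-1}$ and let $N_G(K)$ be the normalizer of $K$ in $G$. Suppose that $(K,g,H)$ is a homoclinic triple, that is, $$gH\cap N_G(K)=\emptyset\qquad\text{and}\qquad K\le H\cap H^g,$$ and that it satisfies in addition [HTL] $\;H\le N_G(K)\cap N_G(K^{g^{-1}})$. Let $M$ be the complex regular representation of $G$, i.e. the space of functions $f:G\to\mathbb C$ with $(a\cdot f)(b)=f(a^{-1}b)$, regarded as a real vector space of dimension $2|G|$. Then there is a set $U$ of $G$-equivariant $C^1$ vector fields on $M$ which is open in the $C^1$ topology (uniform convergence on compact sets of the field and of its first derivative) and contains a $C^\infty$ vector field, such that every $v\in U$ has a relative homoclinic trajectory (RHT) with isotropy $K$ and twist $g$, based at a point of isotropy $H$. (In particular, for each $1\le r\le\infty$ the $C^r$ fields in $U$ form a nonempty open set of $G$-equivariant $C^r$ vector fields.) Explicitly, for every $v\in U$ there are a point $x\in M$ with isotropy subgroup exactly $H$ which is a hyperbolic equilibrium of $v$ ($v(x)=0$ and the real linear map $Dv(x)$ has no eigenvalue with zero real part), and a solution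 $\gamma:\mathbb R\to M$ of $\dot\gamma=v(\gamma)$, such that $\gamma(t)\notin G\cdot x$ and $\gamma(t)$ has isotropy subgroup exactly $K$ for all $t\in\mathbb R$, while $\gamma(t)\to x$ as $t\to-\infty$ and $\gamma(t)\to g\cdot x$ as $t\to+\infty$. -/

import Mathlib

open Filter Topology

open scoped ContDiff Pointwise

namespace RelHom

/-- The conjugate subgroup `K^g = g K g⁻¹`. -/
def conj {G : Type*} [Group G] (K : Subgroup G) (g : G) : Subgroup G :=
  K.map (MulAut.conj g).toMonoidHom

/-- `(K, g, H)` is a homoclinic triple for `G`: the coset `gH` does not meet the normalizer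
of `K`, and `K` is a (not necessarily proper) subgroup of `H ∩ H^g`. -/
structure IsHomoclinicTriple {G : Type*} [Group G] (K : Subgroup G) (g : G) (H : Subgroup G) :
    Prop where
  ht1 : (g • (H : Set G)) ∩ (Subgroup.normalizer (K : Set G) : Set G) = ∅
  ht2 : K ≤ H ⊓ conj H g

/-- Condition [HTL]: `H` is a subgroup of `N_G(K) ∩ N_G(K^(g⁻¹))`. -/
def HTL {G : Type*} [Group G] (K : Subgroup G) (g : G) (H : Subgroup G) : Prop :=
  H ≤ Subgroup.normalizer (K : Set G) ⊓ Subgroup.normalizer (conj K g⁻¹ : Set G)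

/-- The complex regular representation of `G`, on the space `G → ℂ` of complex functions on `G`
(a real vector space of dimension `2|G|`), by left translation: `(g · f) a = f (g⁻¹ a)`. -/
def regRep (G : Type*) [Group G] : Representation ℂ G (G → ℂ) where
  toFun g := LinearMap.funLeft ℂ ℂ (fun a : G => g⁻¹ * a)
  map_one' := by
    ext f a
    simp [LinearMap.funLeft_apply]
  map_mul' g h := by
    refine LinearMap.ext fun f => funext fun a => ?_
    simp [LinearMap.funLeft_apply, mul_assoc]

theorem regRep_apply {G : Type*} [Group G] (g : G) (f : G → ℂ) (a : G) :
    regRep G g f a = f (g⁻¹ * a) := rfl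

/-- `regRep` permutes the standard basis of `G → ℂ` by left multiplication. -/
theorem regRep_single {G : Type*} [Group G] [DecidableEq G] (g a : G) (c : ℂ) :
    regRep G g (Pi.single a c) = Pi.single (g * a) c := by
  funext b
  simp [regRep_apply, Pi.single_apply, inv_mul_eq_iff_eq_mul]

/-- The isotropy subgroup of a point of the regular representation. -/
def isotropy {G : Type*} [Group G] (x : G → ℂ) : Subgroup G where
  carrier := {g | regRep G g x = x}
  one_mem' := by simp
  mul_mem' {a b} ha hb := by
    simp only [Set.mem_ofPred_eq] at ha hb ⊢
    rw [map_mul, Module.End.mul_apply, hb, ha]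
  inv_mem' {a} ha := by
    simp only [Set.mem_ofPred_eq] at ha ⊢
    conv_lhs => rw [← ha]
    rw [← Module.End.mul_apply, ← map_mul, inv_mul_cancel, map_one, Module.End.one_apply]

/-- The group orbit of a point of the regular representation. -/
def orbit {G : Type*} [Group G] (x : G → ℂ) : Set (G → ℂ) :=
  Set.range fun g : G => regRep G g x

/-- The `G`-equivariant vector fields of class `C¹` on the regular representation, regarded as a
real vector space (so that differentiability is real differentiability). -/
structure EquivariantVF (G : Type*) [Group G] [Fintype G] where
  toFun : (G → ℂ) → (G → ℂ)
  contDiff : ContDiff ℝ 1 toFun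
  equivariant : ∀ (g : G) (x : G → ℂ), toFun (regRep G g x) = regRep G g (toFun x)

/-- A vector field together with its derivative, as continuous maps. -/
noncomputable def EquivariantVF.jet {G : Type*} [Group G] [Fintype G] (v : EquivariantVF G) :
    C(G → ℂ, G → ℂ) × C(G → ℂ, (G → ℂ) →L[ℝ] (G → ℂ)) :=
  (⟨v.toFun, v.contDiff.continuous⟩,
    ⟨fderiv ℝ v.toFun, v.contDiff.continuous_fderiv one_ne_zero⟩)

/-- The `C¹` topology: uniform convergence of the vector field and of its first derivative on
compact sets. A set that is open for it is open for the Whitney (strong) `C¹` topology too, and its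
trace on the fields of class `C^r`, `1 ≤ r ≤ ∞`, is open for the weak and strong `C^r`
topologies. -/
noncomputable instance EquivariantVF.instTopologicalSpace {G : Type*} [Group G] [Fintype G] :
    TopologicalSpace (EquivariantVF G) :=
  TopologicalSpace.induced EquivariantVF.jet inferInstance

/-- `x` is a hyperbolic equilibrium of `v`: the linearization of `v` at `x`, a real linear map, has
no eigenvalue (complex root of its characteristic polynomial) with zero real part. For a finite
group the tangent space of an orbit is zero, so that a relative equilibrium is an orbit of
equilibria, and it is normally hyperbolic iff these are hyperbolic. -/
structure IsHyperbolicEquilibrium {G : Type*} [Group G] [Fintype G] (v : EquivariantVF G)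
    (x : G → ℂ) : Prop where
  eq_zero : v.toFun x = 0
  hyperbolic : ∀ z : ℂ,
    Polynomial.aeval z (fderiv ℝ v.toFun x : (G → ℂ) →ₗ[ℝ] (G → ℂ)).charpoly = 0 → z.re ≠ 0

/-- `γ` is a relative homoclinic trajectory of `v` to the (normally hyperbolic) relative equilibrium
`G · x`: an integral curve defined for all times, outside `G · x`, which converges to `G · x` in
both time directions. -/
structure IsRHT {G : Type*} [Group G] [Fintype G] (v : EquivariantVF G) (x : G → ℂ)
    (γ : ℝ → G → ℂ) : Prop where
  equilibrium : IsHyperbolicEquilibrium v x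
  trajectory : ∀ t, HasDerivAt γ (v.toFun (γ t)) t
  notMem_orbit : ∀ t, γ t ∉ orbit x
  tendsto_atBot : Tendsto γ atBot (𝓝ˢ (orbit x))
  tendsto_atTop : Tendsto γ atTop (𝓝ˢ (orbit x))

/-- `v` has a relative homoclinic trajectory with associated triple `(K, g, H)`: its points have
isotropy `K`, its `α`-limit is a point `x` of isotropy `H`, and its `ω`-limit is `g · x`
(that is, `g` is its twist). -/
def HasRHT {G : Type*} [Group G] [Fintype G] (v : EquivariantVF G)
    (K : Subgroup G) (g : G) (H : Subgroup G) : Prop :=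
  ∃ (x : G → ℂ) (γ : ℝ → G → ℂ), IsRHT v x γ ∧
    (∀ t, isotropy (γ t) = K) ∧ isotropy x = H ∧
    Tendsto γ atBot (𝓝 x) ∧ Tendsto γ atTop (𝓝 (regRep G g x))

end RelHom

/-! Write `S` for `conj K g⁻¹` and `x₀` for `basePoint H`, a point with isotropy `H`. By [HTL], `H`
normalizes `S`, so the involution `saddle S`, which is `-1` on Fix(S) and `+1` on the functions of
zero `S`-average, commutes with `H`. It can therefore be prescribed as the linear part of an
equivariant field at `x₀`, and equivariance carries it along the orbit. At `g · x₀` the stable space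
is g Fix(S) = Fix(K), so `g · x₀` is a sink inside the invariant space Fix(K). Since `g` does not
normalize `K`, `S` is not contained in `K`, and Fix(K) contains a nonzero function of zero
`S`-average, that is, an unstable direction at `x₀`. A connection from a saddle to a sink inside
Fix(K) is robust.

The complex values leave room for the connection: the equilibria are real functions, and the curve
leaves `x₀` along an imaginary direction `i ξ` before it moves to `g · x₀` (`exists_profile`,
`curve`). With `ξ 1 = 1` and `ξ ≤ 0` off `K`, translates of the curve by elements outside `K` miss
its interior. The prescribed values are thus consistent over all translates. They are convex
constraints, so a partition of unity gives a smooth field, made equivariant in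
`exists_equivariantVF`.

For `v` that is `C¹`-close, `exists_equilibrium` finds the equilibrium in Fix(H),
`exists_heteroclinic` the connection in Fix(K), and `isHyperbolicEquilibrium_of_norm_sub_le` the
hyperbolicity. Isotropy is constant along trajectories, so it suffices to control it at time `0`. -/

namespace RelHom

/-! ### Global trajectories and the Lyapunov-Perron integral formula. -/

section ODE

open MeasureTheory Set Metric
open scoped NNReal BoundedContinuousFunction

variable {E : Type*} [NormedAddCommGroup E] [NormedSpace ℝ E]

/-- Global existence for a bounded, globally Lipschitz vector field. -/
theorem exists_forall_hasDerivAt_of_lipschitzWith [CompleteSpace E] {w : E → E} {K L : ℝ≥0}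
    (hw : LipschitzWith K w) (hL : ∀ y, ‖w y‖ ≤ L) (y₀ : E) :
    ∃ γ : ℝ → E, γ 0 = y₀ ∧ ∀ t, HasDerivAt γ (w (γ t)) t := by
  have hloc : ∀ n : ℕ, ∃ α : ℝ → E, α 0 = y₀ ∧
      ∀ t ∈ Ioo (-(n + 1) : ℝ) (n + 1), HasDerivAt α (w (α t)) t := by
    intro n
    have h0 : (0 : ℝ) ∈ Icc (-(n + 1) : ℝ) (n + 1) := by
      constructor <;> linarith [n.cast_nonneg (α := ℝ)]
    -- A solution of speed at most `L` moves by at most `L * (n + 1)`, so this radius allows time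
    -- intervals of any length.
    have hp : IsPicardLindelof (fun _ => w) (tmin := -(n + 1)) (tmax := n + 1) ⟨0, h0⟩ y₀
        (L * (n + 1)) 0 L K := by
      refine IsPicardLindelof.of_time_independent (fun y _ => hL y) (hw.lipschitzOnWith) ?_
      simp
    obtain ⟨α, h1, h2⟩ := hp.exists_eq_forall_mem_Icc_hasDerivWithinAt₀
    exact ⟨α, h1, fun t ht => (h2 t (Ioo_subset_Icc_self ht)).hasDerivAt (Icc_mem_nhds ht.1 ht.2)⟩
  choose α h0 hα using hloc
  have huniq : ∀ {n m : ℕ}, n ≤ m → EqOn (α n) (α m) (Ioo (-(n + 1) : ℝ) (n + 1)) := by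
    intro n m hnm
    have hnm' : (n : ℝ) ≤ m := by exact_mod_cast hnm
    refine ODE_solution_unique_of_mem_Ioo (v := fun _ => w) (s := fun _ => univ) (K := K) (t₀ := 0)
      (fun t _ => hw.lipschitzOnWith) ?_ (fun t ht => ⟨hα n t ht, mem_univ _⟩)
      (fun t ht => ⟨hα m t ⟨by linarith [ht.1], by linarith [ht.2]⟩, mem_univ _⟩) (by rw [h0, h0])
    constructor <;> linarith [n.cast_nonneg (α := ℝ)]
  have hmem : ∀ t : ℝ, t ∈ Ioo (-(⌈|t|⌉₊ + 1) : ℝ) (⌈|t|⌉₊ + 1) := by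
    intro t
    have := Nat.le_ceil |t|
    have := abs_le.1 this
    constructor <;> linarith
  refine ⟨fun t => α ⌈|t|⌉₊ t, by simp [h0], fun t => ?_⟩
  have heq : (fun s => α ⌈|s|⌉₊ s) =ᶠ[𝓝 t] α ⌈|t|⌉₊ := by
    filter_upwards [Ioo_mem_nhds (hmem t).1 (hmem t).2] with s hs
    rcases le_total ⌈|s|⌉₊ ⌈|t|⌉₊ with h | h
    · exact huniq h (hmem s)
    · exact (huniq h hs).symm
  exact (hα _ t (hmem t)).congr_of_eventuallyEq heq

/-- A `C¹` vector field can be made bounded and globally Lipschitz without changing it on a given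
ball. -/
theorem exists_lipschitzWith_eqOn_closedBall [FiniteDimensional ℝ E] {w : E → E}
    (hw : ContDiff ℝ 1 w) (R : ℝ) :
    ∃ (w' : E → E) (K L : ℝ≥0), LipschitzWith K w' ∧ (∀ y, ‖w' y‖ ≤ L) ∧
      EqOn w' w (closedBall 0 R) := by
  let χ : ContDiffBump (0 : E) := ⟨|R| + 1, |R| + 2, by positivity, by linarith⟩
  have hc : HasCompactSupport (fun y => χ y • w y) := χ.hasCompactSupport.smul_right
  have hd : ContDiff ℝ 1 (fun y => χ y • w y) := χ.contDiff.smul hw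
  obtain ⟨K, hK⟩ := hd.lipschitzWith_of_hasCompactSupport hc one_ne_zero
  obtain ⟨L, hL⟩ := hc.exists_bound_of_continuous hd.continuous
  refine ⟨_, K, L.toNNReal, hK, fun y => (hL y).trans (Real.le_coe_toNNReal L), fun y hy => ?_⟩
  have : χ y = 1 := χ.one_of_mem_closedBall
    (closedBall_subset_closedBall (by show R ≤ |R| + 1; linarith [le_abs_self R]) hy)
  simp [this]

/-- The solution of `y' = a P y - b (1 - P) y + h` which is bounded on `(-∞, 0]` and satisfies
`P (y 0) = ξ`. -/
noncomputable def dichotomySol (P : E →L[ℝ] E) (a b : ℝ) (ξ : E) (h : ℝ → E) (t : ℝ) : E :=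
  Real.exp (a * t) • (ξ + P (∫ s in (0 : ℝ)..t, Real.exp (-(a * s)) • h s)) +
    Real.exp (-(b * t)) • (1 - P) (∫ s in Iic t, Real.exp (b * s) • h s)

section DichotomySol

variable {P : E →L[ℝ] E} {a b C : ℝ} {ξ : E} {h : ℝ → E}

theorem integrableOn_exp_mul_smul (hb : 0 < b) (hh : Continuous h) (hC : ∀ t, ‖h t‖ ≤ C) (t : ℝ) :
    IntegrableOn (fun s => Real.exp (b * s) • h s) (Iic t) := by
  refine Integrable.mono' ((integrableOn_exp_mul_Iic hb t).mul_const C)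
    (by fun_prop) (Eventually.of_forall fun s => ?_)
  rw [norm_smul, Real.norm_of_nonneg (Real.exp_pos _).le]
  gcongr
  exact hC s

/-- Variation of constants: the unstable part is integrated from time `0`, the stable part from
`-∞`, where `exp (b * s)` makes the integral of a bounded forcing converge. -/
theorem hasDerivAt_dichotomySol [CompleteSpace E] (hP : ∀ y, P (P y) = P y) (hb : 0 < b) (hξ : P ξ = ξ)
    (hh : Continuous h) (hC : ∀ t, ‖h t‖ ≤ C) (t : ℝ) :
    HasDerivAt (dichotomySol P a b ξ h) (a • P (dichotomySol P a b ξ h t) -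
      b • (1 - P) (dichotomySol P a b ξ h t) + h t) t := by
  have h1 : HasDerivAt (fun t => ∫ s in (0 : ℝ)..t, Real.exp (-(a * s)) • h s)
      (Real.exp (-(a * t)) • h t) t :=
    intervalIntegral.integral_hasDerivAt_right
      ((by fun_prop : Continuous fun s => Real.exp (-(a * s)) • h s).intervalIntegrable _ _)
      (Continuous.stronglyMeasurableAtFilter (by fun_prop) _ _) (by fun_prop)
  have hint := integrableOn_exp_mul_smul hb hh hC
  have h2 : HasDerivAt (fun t => ∫ s in Iic t, Real.exp (b * s) • h s)
      (Real.exp (b * t) • h t) t := by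
    have : (fun t => ∫ s in Iic t, Real.exp (b * s) • h s) = fun t =>
        (∫ s in (0 : ℝ)..t, Real.exp (b * s) • h s) + ∫ s in Iic 0, Real.exp (b * s) • h s := by
      funext t
      rw [← intervalIntegral.integral_Iic_sub_Iic (hint 0) (hint t), sub_add_cancel]
    rw [this]
    exact (intervalIntegral.integral_hasDerivAt_right
      ((by fun_prop : Continuous fun s => Real.exp (b * s) • h s).intervalIntegrable _ _)
      (Continuous.stronglyMeasurableAtFilter (by fun_prop) _ _) (by fun_prop)).add_const _
  have e1 : HasDerivAt (fun t => Real.exp (a * t)) (Real.exp (a * t) * a) t := by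
    simpa using ((hasDerivAt_id t).const_mul a).exp
  have e2 : HasDerivAt (fun t => Real.exp (-(b * t))) (Real.exp (-(b * t)) * (-b)) t := by
    simpa using ((hasDerivAt_id t).const_mul b).neg.exp
  have := (e1.smul ((P.hasFDerivAt.comp_hasDerivAt t h1).const_add ξ)).add
    (e2.smul ((1 - P).hasFDerivAt.comp_hasDerivAt t h2))
  refine this.congr_deriv ?_
  simp only [dichotomySol, map_add, map_smul, sub_apply,
    one_apply_eq_self, hP, hξ, map_sub, sub_self, Function.comp_apply, smul_zero, add_zero,
    smul_sub, smul_add, smul_smul, ← Real.exp_add]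
  simp only [show a * t + -(a * t) = 0 by ring, show -(b * t) + b * t = 0 by ring, Real.exp_zero,
    one_smul]
  module

theorem proj_dichotomySol_zero (hP : ∀ y, P (P y) = P y) (hξ : P ξ = ξ) :
    P (dichotomySol P a b ξ h 0) = ξ := by
  simp [dichotomySol, hP, hξ]

theorem norm_exp_smul_integral_Iic_le (hb : 0 < b) (hC : ∀ t, ‖h t‖ ≤ C) (t : ℝ) :
    ‖Real.exp (-(b * t)) • (1 - P) (∫ s in Iic t, Real.exp (b * s) • h s)‖ ≤ ‖1 - P‖ / b * C := by
  have h1 : ‖∫ s in Iic t, Real.exp (b * s) • h s‖ ≤ Real.exp (b * t) / b * C := by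
    rw [← integral_exp_mul_Iic hb t, ← integral_mul_const]
    refine norm_integral_le_of_norm_le ((integrableOn_exp_mul_Iic hb t).mul_const C)
      (Eventually.of_forall fun s => ?_)
    rw [norm_smul, Real.norm_of_nonneg (Real.exp_pos _).le]
    gcongr
    exact hC s
  rw [norm_smul, Real.norm_of_nonneg (Real.exp_pos _).le]
  calc _ ≤ Real.exp (-(b * t)) * (‖1 - P‖ * (Real.exp (b * t) / b * C)) := by
        gcongr
        exact ((1 - P).le_opNorm _).trans (by gcongr)
    _ = (Real.exp (-(b * t)) * Real.exp (b * t)) * (‖1 - P‖ / b * C) := by ring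
    _ = _ := by rw [← Real.exp_add]; simp

theorem norm_exp_smul_intervalIntegral_le (ha : 0 < a) (hC : ∀ t, ‖h t‖ ≤ C) {t : ℝ} (ht : t ≤ 0) :
    ‖Real.exp (a * t) • P (∫ s in (0 : ℝ)..t, Real.exp (-(a * s)) • h s)‖ ≤ ‖P‖ / a * C := by
  have hC0 : 0 ≤ C := (norm_nonneg _).trans (hC 0)
  have h1 : ‖∫ s in (0 : ℝ)..t, Real.exp (-(a * s)) • h s‖ ≤ Real.exp (-(a * t)) / a * C := by
    rw [intervalIntegral.integral_symm, norm_neg]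
    calc _ ≤ ∫ s in t..0, Real.exp (-(a * s)) * C := by
          refine intervalIntegral.norm_integral_le_of_norm_le ht
            (Eventually.of_forall fun s _ => ?_)
            ((by fun_prop : Continuous fun s => Real.exp (-(a * s)) * C).intervalIntegrable _ _)
          rw [norm_smul, Real.norm_of_nonneg (Real.exp_pos _).le]
          gcongr
          exact hC s
      _ = (Real.exp (-(a * t)) - 1) / a * C := by
          rw [intervalIntegral.integral_mul_const]
          congr 1
          have : ∀ s ∈ uIcc t 0, HasDerivAt (fun s => -(Real.exp (-(a * s)) / a))
              (Real.exp (-(a * s))) s := by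
            intro s _
            refine ((((hasDerivAt_id s).const_mul a).neg.exp.div_const a).neg).congr_deriv ?_
            simp
            field_simp
          rw [intervalIntegral.integral_eq_sub_of_hasDerivAt this
            ((by fun_prop : Continuous fun s => Real.exp (-(a * s))).intervalIntegrable _ _)]
          simp
          ring
      _ ≤ _ := by gcongr; linarith
  rw [norm_smul, Real.norm_of_nonneg (Real.exp_pos _).le]
  calc _ ≤ Real.exp (a * t) * (‖P‖ * (Real.exp (-(a * t)) / a * C)) := by
        gcongr
        exact (P.le_opNorm _).trans (by gcongr)
    _ = (Real.exp (a * t) * Real.exp (-(a * t))) * (‖P‖ / a * C) := by ring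
    _ = _ := by rw [← Real.exp_add]; simp

theorem norm_dichotomySol_le (ha : 0 < a) (hb : 0 < b) (hC : ∀ t, ‖h t‖ ≤ C) {t : ℝ} (ht : t ≤ 0) :
    ‖dichotomySol P a b ξ h t‖ ≤ ‖ξ‖ + (‖P‖ / a + ‖1 - P‖ / b) * C := by
  have h1 := norm_exp_smul_intervalIntegral_le (P := P) ha hC ht
  have h2 := norm_exp_smul_integral_Iic_le (P := P) hb hC t
  have h3 : ‖Real.exp (a * t) • ξ‖ ≤ ‖ξ‖ := by
    rw [norm_smul, Real.norm_of_nonneg (Real.exp_pos _).le]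
    have : Real.exp (a * t) ≤ 1 := Real.exp_le_one_iff.2 (by nlinarith)
    nlinarith [norm_nonneg ξ]
  rw [dichotomySol, smul_add]
  refine (norm_add_le _ _).trans ?_
  have := norm_add_le (Real.exp (a * t) • ξ)
    (Real.exp (a * t) • P (∫ s in (0 : ℝ)..t, Real.exp (-(a * s)) • h s))
  linarith

/-- At time `0` only the stable integral remains. It measures how far the unstable manifold departs
from its linear model. -/
theorem norm_dichotomySol_zero_sub_le (hb : 0 < b) (hC : ∀ t, ‖h t‖ ≤ C) :
    ‖dichotomySol P a b ξ h 0 - ξ‖ ≤ ‖1 - P‖ / b * C := by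
  simpa [dichotomySol] using norm_exp_smul_integral_Iic_le (P := P) hb hC 0

theorem dichotomySol_sub (hb : 0 < b) {h' : ℝ → E} {C' : ℝ} (hh : Continuous h)
    (hC : ∀ t, ‖h t‖ ≤ C) (hh' : Continuous h') (hC' : ∀ t, ‖h' t‖ ≤ C') (t : ℝ) :
    dichotomySol P a b ξ h t - dichotomySol P a b ξ h' t = dichotomySol P a b 0 (h - h') t := by
  have h1 : ∫ s in (0 : ℝ)..t, Real.exp (-(a * s)) • (h s - h' s) =
      (∫ s in (0 : ℝ)..t, Real.exp (-(a * s)) • h s) -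
        ∫ s in (0 : ℝ)..t, Real.exp (-(a * s)) • h' s := by
    simp_rw [smul_sub]
    exact intervalIntegral.integral_sub (Continuous.intervalIntegrable (by fun_prop) _ _)
      (Continuous.intervalIntegrable (by fun_prop) _ _)
  have h2 : ∫ s in Iic t, Real.exp (b * s) • (h s - h' s) =
      (∫ s in Iic t, Real.exp (b * s) • h s) - ∫ s in Iic t, Real.exp (b * s) • h' s := by
    simp_rw [smul_sub]
    exact integral_sub (integrableOn_exp_mul_smul hb hh hC t)
      (integrableOn_exp_mul_smul hb hh' hC' t)
  simp only [dichotomySol, Pi.sub_apply, h1, h2, map_sub]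
  module

end DichotomySol

end ODE

/-! ### Trajectories in the unstable manifold. -/

section Heteroclinic

open MeasureTheory Set Metric
open scoped NNReal BoundedContinuousFunction

variable {E : Type*} [NormedAddCommGroup E] [NormedSpace ℝ E]

/-- Lyapunov-Perron: the bounded solutions on `(-∞, 0]` of a small Lipschitz perturbation of
`z' = a P z - b (1 - P) z` can be prescribed by their unstable component at time `0`. -/
theorem exists_bounded_solution_Iic [CompleteSpace E] {P : E →L[ℝ] E} {a b ε ρ : ℝ} {ξ : E}
    {R : ℝ → E → E} (hP : ∀ y, P (P y) = P y) (ha : 0 < a) (hb : 0 < b) (hε : 0 ≤ ε) (hρ : 0 ≤ ρ)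
    (hξ : P ξ = ξ) (hξρ : ‖ξ‖ ≤ ρ / 2) (hR : Continuous (Function.uncurry R))
    (hR0 : ∀ t, R t 0 = 0)
    (hRε : ∀ t ≤ 0, ∀ y ∈ closedBall (0 : E) ρ, ∀ z ∈ closedBall (0 : E) ρ,
      ‖R t y - R t z‖ ≤ ε * ‖y - z‖)
    (hκ : (‖P‖ / a + ‖1 - P‖ / b) * ε ≤ 1 / 2) :
    ∃ z : ℝ → E, (∀ t ≤ 0, ‖z t‖ ≤ ρ ∧
        HasDerivAt z (a • P (z t) - b • (1 - P) (z t) + R t (z t)) t) ∧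
      P (z 0) = ξ ∧ ‖z 0 - ξ‖ ≤ ‖1 - P‖ / b * (ε * ρ) := by
  let X := closedBall (0 : ℝ →ᵇ E) ρ
  have hmem : ∀ (z : X) t, (z : ℝ →ᵇ E) t ∈ closedBall (0 : E) ρ := fun z t => by
    have := (z : ℝ →ᵇ E).norm_coe_le_norm t
    exact mem_closedBall_zero_iff.2 (this.trans (mem_closedBall_zero_iff.1 z.2))
  -- Time is frozen at `0` for positive arguments, so that the fixed point can be sought among
  -- bounded functions on the whole line.
  let N : X → ℝ → E := fun z s => R (min s 0) ((z : ℝ →ᵇ E) (min s 0))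
  have hNc : ∀ z, Continuous (N z) := fun z =>
    hR.comp ((continuous_id.min continuous_const).prodMk
      ((z : ℝ →ᵇ E).continuous.comp (continuous_id.min continuous_const)))
  have hNb : ∀ z s, ‖N z s‖ ≤ ε * ρ := fun z s => by
    have h1 := hRε (min s 0) (min_le_right _ _) _ (hmem z (min s 0)) 0 (by simpa using hρ)
    rw [hR0, sub_zero, sub_zero] at h1
    exact h1.trans (by gcongr; simpa using hmem z (min s 0))
  have hNs : ∀ (z z' : X) s, ‖(N z - N z') s‖ ≤ ε * dist z z' := fun z z' s => by
    refine (hRε (min s 0) (min_le_right _ _) _ (hmem z _) _ (hmem z' _)).trans ?_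
    gcongr
    rw [← dist_eq_norm]
    exact BoundedContinuousFunction.dist_coe_le_dist _
  have hY := fun z => hasDerivAt_dichotomySol (a := a) hP hb hξ (hNc z) (hNb z)
  have hYc : ∀ z, Continuous (dichotomySol P a b ξ (N z)) := fun z =>
    continuous_iff_continuousAt.2 fun t => (hY z t).continuousAt
  have hYb : ∀ z t, ‖dichotomySol P a b ξ (N z) (min t 0)‖ ≤ ρ := fun z t => by
    have := norm_dichotomySol_le (ξ := ξ) (P := P) ha hb (hNb z) (min_le_right t 0)
    nlinarith
  have hΨ : ∀ z : X, ∃ y : X, ∀ t, (y : ℝ →ᵇ E) t = dichotomySol P a b ξ (N z) (min t 0) :=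
    fun z => ⟨⟨BoundedContinuousFunction.ofNormedAddCommGroup
      (fun t => dichotomySol P a b ξ (N z) (min t 0))
      ((hYc z).comp (continuous_id.min continuous_const)) ρ (hYb z), by
        rw [mem_closedBall_zero_iff]
        exact BoundedContinuousFunction.norm_ofNormedAddCommGroup_le _ hρ (hYb z)⟩,
      fun t => rfl⟩
  choose Ψ hΨ using hΨ
  have hcontr : ContractingWith (1 / 2 : ℝ≥0) Ψ := by
    refine ⟨by norm_num, LipschitzWith.of_dist_le_mul fun z z' => ?_⟩
    rw [Subtype.dist_eq, BoundedContinuousFunction.dist_le (by positivity)]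
    intro t
    rw [hΨ, hΨ, dist_eq_norm, dichotomySol_sub hb (hNc z) (hNb z) (hNc z') (hNb z')]
    refine (norm_dichotomySol_le ha hb (hNs z z') (min_le_right t 0)).trans ?_
    rw [norm_zero, zero_add, ← mul_assoc]
    gcongr
    simpa using hκ
  have : CompleteSpace X := (isClosed_closedBall).completeSpace_coe
  have : Nonempty X := ⟨⟨0, by simpa [X] using hρ⟩⟩
  obtain ⟨z, hz⟩ : ∃ z, Ψ z = z := ⟨_, hcontr.fixedPoint_isFixedPt⟩
  have hzt : ∀ t ≤ 0, (z : ℝ →ᵇ E) t = dichotomySol P a b ξ (N z) t := fun t ht => by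
    conv_lhs => rw [← hz, hΨ, min_eq_left ht]
  -- The fixed point is frozen after time `0`. The integral formula agrees with it for `t ≤ 0` and
  -- has a two-sided derivative at `0` as well.
  refine ⟨dichotomySol P a b ξ (N z), fun t ht => ⟨?_, ?_⟩, ?_, ?_⟩
  · simpa [min_eq_left ht] using hYb z t
  · refine (hY z t).congr_deriv ?_
    simp only [N, min_eq_left ht, hzt t ht]
  · exact proj_dichotomySol_zero hP hξ
  · exact norm_dichotomySol_zero_sub_le hb (hNb z)

/-- Trajectories on `(-∞, 0]` in the unstable manifold of a hyperbolic equilibrium `x`, for a field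
that is close to `y ↦ P (y - x) - (1 - P) (y - x)`. -/
theorem exists_unstable_trajectory [CompleteSpace E] {P : E →L[ℝ] E} {ε ρ : ℝ} {x ξ : E}
    {w : E → E} (hP : ∀ y, P (P y) = P y) (hε : 0 ≤ ε) (hρ : 0 ≤ ρ) (hξ : P ξ = ξ)
    (hξρ : ‖ξ‖ ≤ ρ / 2) (hw : Continuous w) (hx : w x = 0)
    (hwε : ∀ y ∈ closedBall x ρ, ∀ z ∈ closedBall x ρ,
      ‖(w y - (P y - (1 - P) y)) - (w z - (P z - (1 - P) z))‖ ≤ ε * ‖y - z‖)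
    (hκ : (2 * ‖P‖ + ‖1 - P‖) * ε ≤ 1 / 2) :
    ∃ y : ℝ → E, (∀ t ≤ 0, ‖y t - x‖ ≤ Real.exp (t / 2) * ρ ∧ HasDerivAt y (w (y t)) t) ∧
      ‖y 0 - (x + ξ)‖ ≤ ‖1 - P‖ * (ε * ρ) := by
  let r : E → E := fun u => w (x + u) - (P u - (1 - P) u)
  have hrc : Continuous r := by fun_prop
  have hr : ∀ u ∈ closedBall (0 : E) ρ, ∀ v ∈ closedBall (0 : E) ρ, ‖r u - r v‖ ≤ ε * ‖u - v‖ := by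
    intro u hu v hv
    have := hwε (x + u) (by simpa using hu) (x + v) (by simpa using hv)
    simp only [r]
    convert this using 2
    · simp only [map_add]; abel
    · abel_nf
  have hr0 : r 0 = 0 := by simp [r, hx]
  -- The substitution `y = x + exp (t / 2) • z` turns the rates `1, -1` into `1 / 2, -3 / 2` and
  -- keeps the Lipschitz constant of the remainder. A bounded `z` then gives exponential convergence
  -- of `y` to `x`.
  let R : ℝ → E → E := fun t u => Real.exp (-(t / 2)) • r (Real.exp (t / 2) • u)
  have hRc : Continuous (Function.uncurry R) := by
    have : Continuous fun p : ℝ × E => Real.exp (-(p.1 / 2)) • r (Real.exp (p.1 / 2) • p.2) := by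
      fun_prop
    exact this
  have hscale : ∀ t ≤ 0, ∀ u ∈ closedBall (0 : E) ρ, Real.exp (t / 2) • u ∈ closedBall (0 : E) ρ := by
    intro t ht u hu
    rw [mem_closedBall_zero_iff] at hu ⊢
    rw [norm_smul, Real.norm_of_nonneg (Real.exp_pos _).le]
    have : Real.exp (t / 2) ≤ 1 := Real.exp_le_one_iff.2 (by linarith)
    nlinarith [norm_nonneg u]
  obtain ⟨z, hz, -, hz0⟩ := exists_bounded_solution_Iic (a := 1 / 2) (b := 3 / 2) (R := R) hP
    (by norm_num) (by norm_num) hε hρ hξ hξρ hRc (by simp [R, hr0]) (by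
      intro t ht u hu v hv
      have := hr _ (hscale t ht u hu) _ (hscale t ht v hv)
      simp only [R]
      rw [← smul_sub, norm_smul, Real.norm_of_nonneg (Real.exp_pos _).le]
      rw [← smul_sub, norm_smul, Real.norm_of_nonneg (Real.exp_pos _).le] at this
      calc _ ≤ Real.exp (-(t / 2)) * (ε * (Real.exp (t / 2) * ‖u - v‖)) := by gcongr
        _ = (Real.exp (-(t / 2)) * Real.exp (t / 2)) * (ε * ‖u - v‖) := by ring
        _ = _ := by rw [← Real.exp_add]; simp)
    (by
      refine le_trans ?_ hκ
      gcongr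
      · apply le_of_eq; ring
      · exact div_le_self (norm_nonneg _) (by norm_num))
  refine ⟨fun t => x + Real.exp (t / 2) • z t, fun t ht => ⟨?_, ?_⟩, ?_⟩
  · rw [add_sub_cancel_left, norm_smul, Real.norm_of_nonneg (Real.exp_pos _).le]
    gcongr
    exact (hz t ht).1
  · have e1 : HasDerivAt (fun t : ℝ => Real.exp (t / 2)) (Real.exp (t / 2) * (1 / 2)) t := by
      simpa using ((hasDerivAt_id t).div_const 2).exp
    refine ((e1.smul (hz t ht).2).const_add x).congr_deriv ?_
    have hexp : Real.exp (t / 2) * Real.exp (-(t / 2)) = 1 := by rw [← Real.exp_add]; simp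
    have hR : Real.exp (t / 2) • R t (z t) = r (Real.exp (t / 2) • z t) := by
      simp only [R, smul_smul, hexp, one_smul]
    rw [smul_add _ _ (R t (z t)), hR]
    simp only [r, map_smul, sub_apply, one_apply_eq_self]
    module
  · simp only [zero_div, Real.exp_zero, one_smul, add_sub_add_left_eq_sub]
    refine hz0.trans ?_
    gcongr
    exact div_le_self (norm_nonneg _) (by norm_num)

end Heteroclinic

/-! ### Robustness of connections from a saddle to a sink. -/

section Persistence

open Set Metric
open scoped NNReal

variable {E : Type*} [NormedAddCommGroup E] [NormedSpace ℝ E]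

/-- Trajectories of a field `w` that is uniformly close to `u` follow those of `u` in finite
time. -/
theorem norm_sub_le_exp_of_trajectory {u w : E → E} {K : ℝ≥0} {ε δ r T : ℝ} {ζ β : ℝ → E}
    {s : Set E} (hε : 0 ≤ ε) (hδ : ε < δ) (hK : LipschitzOnWith K u s)
    (hζ : ∀ t ∈ Icc 0 T, HasDerivAt ζ (u (ζ t)) t) (hζs : ∀ t ∈ Icc 0 T, closedBall (ζ t) r ⊆ s)
    (hβ : ∀ t, HasDerivAt β (w (β t)) t) (hw : ∀ y ∈ s, ‖w y - u y‖ ≤ ε)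
    (h0 : ‖β 0 - ζ 0‖ ≤ δ) (hr : δ * Real.exp ((K + 1) * T) ≤ r) :
    ∀ t ∈ Icc 0 T, ‖β t - ζ t‖ ≤ δ * Real.exp ((K + 1) * t) := by
  have hδ0 : 0 < δ := hε.trans_lt hδ
  have hB : ∀ t, HasDerivAt (fun t : ℝ => δ * Real.exp ((K + 1) * t))
      ((K + 1) * (δ * Real.exp ((K + 1) * t))) t := fun t => by
    refine ((((hasDerivAt_id t).const_mul ((K : ℝ) + 1)).exp).const_mul δ).congr_deriv ?_
    simp
    ring
  -- Where the norm equals the bound `B`, the derivative is at most `ε + K * B < (K + 1) * B`,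
  -- because `ε < δ ≤ B`.
  refine image_norm_le_of_norm_deriv_right_lt_deriv_boundary (f := fun t => β t - ζ t)
    (f' := fun t => w (β t) - u (ζ t))
    (fun t ht => ((hβ t).sub (hζ t ht)).continuousAt.continuousWithinAt)
    (fun t ht => ((hβ t).sub (hζ t (Ico_subset_Icc_self ht))).hasDerivWithinAt)
    (by simpa using h0) hB fun t ht hn => ?_
  have ht' := Ico_subset_Icc_self ht
  have hKpos : (0 : ℝ) ≤ K := K.2
  have hle : δ * Real.exp ((K + 1) * t) ≤ r := by
    refine le_trans ?_ hr
    have := ht'.2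
    gcongr
  have hr0 : 0 ≤ r := (by positivity : (0 : ℝ) ≤ δ * Real.exp ((K + 1) * t)).trans hle
  have hβs : β t ∈ s := hζs t ht' (by rw [mem_closedBall, dist_eq_norm, hn]; exact hle)
  have hζm : ζ t ∈ s := hζs t ht' (mem_closedBall_self hr0)
  have h1 : ‖u (β t) - u (ζ t)‖ ≤ K * ‖β t - ζ t‖ := by
    simpa [dist_eq_norm] using hK.dist_le_mul _ hβs _ hζm
  have h2 : δ ≤ δ * Real.exp ((K + 1) * t) :=
    le_mul_of_one_le_right hδ0.le (Real.one_le_exp (mul_nonneg (by positivity) ht.1))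
  calc ‖w (β t) - u (ζ t)‖ = ‖(w (β t) - u (β t)) + (u (β t) - u (ζ t))‖ := by congr 1; abel
    _ ≤ ε + K * ‖β t - ζ t‖ := (norm_add_le _ _).trans (add_le_add (hw _ hβs) h1)
    _ < _ := by rw [hn]; linarith

/-- A trajectory that enters a ball around `q`, in which the field is close to `y ↦ -(y - q)`,
converges to `q` exponentially. -/
theorem norm_sub_le_exp_of_sink {w : E → E} {ε b T : ℝ} {q : E} {β : ℝ → E} (hε : ε < 1 / 2)
    (hb : 0 < b) (hβ : ∀ t, HasDerivAt β (w (β t)) t)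
    (hw : ∀ y ∈ closedBall q b, ‖w y + (y - q)‖ ≤ ε * ‖y - q‖) (hT : ‖β T - q‖ ≤ b) :
    ∀ t ≥ T, ‖β t - q‖ ≤ b * Real.exp (-((t - T) / 2)) := by
  intro t ht
  have hexp : ∀ t, HasDerivAt (fun t => Real.exp (t - T)) (Real.exp (t - T)) t := fun t => by
    simpa using ((hasDerivAt_id t).sub_const T).exp
  have hB : ∀ t, HasDerivAt (fun t => b * Real.exp ((t - T) / 2))
      (b * Real.exp ((t - T) / 2) / 2) t := fun t => by
    refine ((((hasDerivAt_id t).sub_const T).div_const 2).exp.const_mul b).congr_deriv ?_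
    simp
    ring
  -- The factor `exp (t - T)` cancels the linear part of the sink. What remains grows at rate at
  -- most `ε < 1 / 2`, slower than the factor itself.
  have hf : ∀ t, HasDerivAt (fun t => Real.exp (t - T) • (β t - q))
      (Real.exp (t - T) • (w (β t) + (β t - q))) t := fun t => by
    refine ((hexp t).smul ((hβ t).sub_const q)).congr_deriv ?_
    rw [smul_add]
  have key := image_norm_le_of_norm_deriv_right_lt_deriv_boundary (a := T) (b := t)
    (fun t _ => (hf t).continuousAt.continuousWithinAt) (fun t _ => (hf t).hasDerivWithinAt)
    (by simpa using hT) hB (fun s hs hn => ?_) (right_mem_Icc.2 ht)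
  · rw [norm_smul, Real.norm_of_nonneg (Real.exp_pos _).le] at key
    calc ‖β t - q‖ = Real.exp (-(t - T)) * (Real.exp (t - T) * ‖β t - q‖) := by
          rw [← mul_assoc, ← Real.exp_add]; simp
      _ ≤ Real.exp (-(t - T)) * (b * Real.exp ((t - T) / 2)) := by gcongr
      _ = b * (Real.exp (-(t - T)) * Real.exp ((t - T) / 2)) := by ring
      _ = _ := by rw [← Real.exp_add]; ring_nf
  · rw [norm_smul, Real.norm_of_nonneg (Real.exp_pos _).le] at hn ⊢
    have hmem : β s ∈ closedBall q b := by
      rw [mem_closedBall, dist_eq_norm]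
      have h1 : Real.exp ((s - T) / 2) ≤ Real.exp (s - T) :=
        Real.exp_le_exp.2 (by linarith [hs.1])
      have h2 : Real.exp (s - T) * ‖β s - q‖ ≤ Real.exp (s - T) * b := by rw [hn]; nlinarith
      exact le_of_mul_le_mul_left h2 (Real.exp_pos _)
    have hpos : 0 < b * Real.exp ((s - T) / 2) := by positivity
    calc _ ≤ Real.exp (s - T) * (ε * ‖β s - q‖) := by gcongr; exact hw _ hmem
      _ = ε * (b * Real.exp ((s - T) / 2)) := by rw [← hn]; ring
      _ < _ := by nlinarith

theorem hasDerivAt_ite_le {f f₁ f₂ : ℝ → E} {w : E → E} (hf : f = fun t => if t ≤ 0 then f₁ t else f₂ t)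
    (h₀ : f₁ 0 = f₂ 0) (h₁ : ∀ t ≤ 0, HasDerivAt f₁ (w (f₁ t)) t)
    (h₂ : ∀ t ≥ 0, HasDerivAt f₂ (w (f₂ t)) t) (t : ℝ) : HasDerivAt f (w (f t)) t := by
  subst hf
  rcases lt_trichotomy t 0 with ht | rfl | ht
  · simp only [ht.le, if_true]
    refine (h₁ t ht.le).congr_of_eventuallyEq ?_
    filter_upwards [Iio_mem_nhds ht] with s hs
    simp [(mem_Iio.1 hs).le]
  · have hl : HasDerivWithinAt (fun t => if t ≤ 0 then f₁ t else f₂ t) (w (f₁ 0)) (Iic 0) 0 :=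
      (h₁ 0 le_rfl).hasDerivWithinAt.congr (fun s hs => by simp [mem_Iic.1 hs]) (by simp)
    have hr : HasDerivWithinAt (fun t => if t ≤ 0 then f₁ t else f₂ t) (w (f₁ 0)) (Ici 0) 0 := by
      rw [h₀]
      refine (h₂ 0 le_rfl).hasDerivWithinAt.congr (fun s hs => ?_) (by simp [h₀])
      rcases (mem_Ici.1 hs).eq_or_lt with rfl | hs
      · simp [h₀]
      · simp [hs.not_ge]
    simpa using hl.union hr
  · simp only [ht.not_ge, if_false]
    refine (h₂ t ht.le).congr_of_eventuallyEq ?_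
    filter_upwards [Ioi_mem_nhds ht] with s hs
    simp [(mem_Ioi.1 hs).not_ge]

/-- Persistence of a heteroclinic trajectory from a hyperbolic equilibrium to a sink. -/
theorem exists_heteroclinic [FiniteDimensional ℝ E] {P : E →L[ℝ] E} {u : E → E} {K : ℝ≥0}
    {R r T : ℝ} {x q ξ : E} {ζ : ℝ → E} (hP : ∀ y, P (P y) = P y) (hr : 0 < r) (hT : 0 ≤ T)
    (hK : LipschitzOnWith K u (closedBall 0 R))
    (hux : ∀ y ∈ closedBall x r, u y = P (y - x) - (1 - P) (y - x))
    (huq : ∀ y ∈ closedBall q r, u y = -(y - q))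
    (hxR : closedBall x r ⊆ closedBall 0 R) (hqR : closedBall q r ⊆ closedBall 0 R)
    (hζ : ∀ t ∈ Icc 0 T, HasDerivAt ζ (u (ζ t)) t)
    (hζR : ∀ t ∈ Icc 0 T, closedBall (ζ t) r ⊆ closedBall 0 R)
    (hζ0 : ζ 0 = x + ξ) (hξ : P ξ = ξ) (hξr : ‖ξ‖ ≤ r / 4) (hζT : ‖ζ T - q‖ ≤ r / 4)
    {η : ℝ} (hη : 0 < η) :
    ∃ ε > 0, ∀ w : E → E, ContDiff ℝ 1 w → (∀ y ∈ closedBall 0 R, ‖w y - u y‖ ≤ ε) →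
      (∀ y ∈ closedBall 0 R, ∀ z ∈ closedBall 0 R,
        ‖(w y - u y) - (w z - u z)‖ ≤ ε * ‖y - z‖) →
      ∀ x' q', w x' = 0 → w q' = 0 → ‖x' - x‖ ≤ ε → ‖q' - q‖ ≤ ε →
      ∃ γ : ℝ → E, (∀ t, HasDerivAt γ (w (γ t)) t) ∧ Tendsto γ atBot (𝓝 x') ∧
        Tendsto γ atTop (𝓝 q') ∧ ‖γ 0 - ζ 0‖ ≤ η := by
  have : CompleteSpace E := FiniteDimensional.complete ℝ E
  -- `ε * D` bounds the gap at time `0` (displacement of `x` plus bending of the unstable manifold)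
  -- with slack that makes it exceed `ε`. `B` is its growth factor up to time `T`.
  let D : ℝ := 2 + ‖1 - P‖ * r
  let B : ℝ := Real.exp ((K + 1) * T)
  have hD : 2 ≤ D := by simp only [D]; linarith [mul_nonneg (norm_nonneg (1 - P)) hr.le]
  have hB : 1 ≤ B := Real.one_le_exp (mul_nonneg (by positivity) hT)
  have hκ0 : 0 ≤ 2 * ‖P‖ + ‖1 - P‖ := by positivity
  obtain ⟨ε, hε, h1, h2, h3, h4, h5⟩ : ∃ ε : ℝ, 0 < ε ∧ ε < 1 / 2 ∧ ε ≤ r / 16 ∧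
      (2 * ‖P‖ + ‖1 - P‖) * ε ≤ 1 / 2 ∧ ε * D * B ≤ r / 4 ∧ ε * D * B ≤ η := by
    have hcont : ∀ c : ℝ, Tendsto (fun ε : ℝ => c * ε) (𝓝[>] 0) (𝓝 0) := fun c => by
      have : Tendsto (fun ε : ℝ => c * ε) (𝓝 0) (𝓝 (c * 0)) :=
        tendsto_id.const_mul c
      rw [mul_zero] at this
      exact this.mono_left nhdsWithin_le_nhds
    have e1 := (hcont 1).eventually_lt_const (show (0 : ℝ) < 1 / 2 by norm_num)
    have e2 := (hcont 1).eventually_lt_const (show (0 : ℝ) < r / 16 by positivity)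
    have e3 := (hcont (2 * ‖P‖ + ‖1 - P‖)).eventually_lt_const (show (0 : ℝ) < 1 / 2 by norm_num)
    have e4 := (hcont (D * B)).eventually_lt_const (show (0 : ℝ) < r / 4 by positivity)
    have e5 := (hcont (D * B)).eventually_lt_const hη
    obtain ⟨ε, h0, h1, h2, h3, h4, h5⟩ :=
      ((eventually_mem_nhdsWithin (a := (0 : ℝ)) (s := Ioi 0)).and (e1.and (e2.and (e3.and (e4.and e5))))).exists
    rw [one_mul] at h1 h2
    exact ⟨ε, h0, h1, h2.le, h3.le, by linarith, by linarith⟩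
  refine ⟨ε, hε, fun w hw hwu hwl x' q' hx' hq' hxx hqq => ?_⟩
  have hsub : closedBall x' (r / 2) ⊆ closedBall x r :=
    closedBall_subset_closedBall' (by rw [dist_eq_norm]; linarith)
  have hsubq : closedBall q' (5 * r / 8) ⊆ closedBall q r :=
    closedBall_subset_closedBall' (by rw [dist_eq_norm]; linarith)
  obtain ⟨y, hy, hy0⟩ := exists_unstable_trajectory (ρ := r / 2) hP hε.le (by positivity) hξ
    (by linarith) hw.continuous hx' (by
      intro y hy z hz
      have := hwl y (hxR (hsub hy)) z (hxR (hsub hz))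
      rw [hux y (hsub hy), hux z (hsub hz)] at this
      convert this using 2
      simp only [map_sub]
      abel) h3
  -- The cut-off field has a global solution. `hβR` shows that for `t ≥ 0` it stays where nothing
  -- was cut off.
  obtain ⟨w', K', L, hw'K, hw'L, hw'⟩ := exists_lipschitzWith_eqOn_closedBall hw R
  obtain ⟨β, hβ0, hβ⟩ := exists_forall_hasDerivAt_of_lipschitzWith hw'K hw'L (y 0)
  have hδ : ε < ε * D := by nlinarith
  have hyζ : ‖y 0 - ζ 0‖ ≤ ε * D := by
    calc ‖y 0 - ζ 0‖ = ‖(y 0 - (x' + ξ)) + (x' - x)‖ := by rw [hζ0]; congr 1; abel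
      _ ≤ ‖1 - P‖ * (ε * (r / 2)) + ε := (norm_add_le _ _).trans (add_le_add hy0 hxx)
      _ ≤ ε * D := by
        have : 0 ≤ ε * (‖1 - P‖ * r) := by positivity
        simp only [D]; nlinarith
  have hfol := norm_sub_le_exp_of_trajectory (r := r) (w := w') hε.le hδ hK hζ hζR hβ
    (fun z hz => by rw [hw' hz]; exact hwu z hz) (by rwa [hβ0]) (h4.trans (by linarith))
  -- The three contributions are `r / 4`, `r / 4` and `r / 16`.
  have hβT : ‖β T - q'‖ ≤ 5 * r / 8 := by
    have := hfol T (right_mem_Icc.2 hT)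
    calc ‖β T - q'‖ = ‖(β T - ζ T) + (ζ T - q) - (q' - q)‖ := by congr 1; abel
      _ ≤ ‖β T - ζ T‖ + ‖ζ T - q‖ + ‖q' - q‖ :=
        (norm_sub_le _ _).trans (add_le_add_left (norm_add_le _ _) _)
      _ ≤ _ := by linarith
  have hq'R : q' ∈ closedBall 0 R := hqR (hsubq (mem_closedBall_self (by positivity)))
  have hsink := norm_sub_le_exp_of_sink (w := w') h1 (by positivity) hβ (fun z hz => by
    have hz' := hsubq hz
    rw [hw' (hqR hz')]
    have := hwl z (hqR hz') q' hq'R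
    rw [huq z hz', huq q' (hsubq (mem_closedBall_self (by positivity))), hq'] at this
    convert this using 2
    abel) hβT
  have hβR : ∀ t ≥ 0, β t ∈ closedBall 0 R := by
    intro t ht
    rcases le_total t T with htT | htT
    · refine hζR t ⟨ht, htT⟩ ?_
      rw [mem_closedBall, dist_eq_norm]
      refine (hfol t ⟨ht, htT⟩).trans ?_
      have : Real.exp ((K + 1) * t) ≤ B := by simp only [B]; gcongr
      have : ε * D * Real.exp ((K + 1) * t) ≤ ε * D * B := by gcongr
      linarith
    · refine hqR (hsubq ?_)
      rw [mem_closedBall, dist_eq_norm]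
      refine (hsink t htT).trans (mul_le_of_le_one_right (by positivity) ?_)
      exact Real.exp_le_one_iff.2 (by linarith)
  refine ⟨fun t => if t ≤ 0 then y t else β t,
    hasDerivAt_ite_le rfl hβ0.symm (fun t ht => (hy t ht).2)
      (fun t ht => by simpa [hw' (hβR t ht)] using hβ t), ?_, ?_, ?_⟩
  · have : Tendsto y atBot (𝓝 x') := by
      rw [tendsto_iff_norm_sub_tendsto_zero]
      refine squeeze_zero' (Eventually.of_forall fun _ => norm_nonneg _)
        ((eventually_le_atBot 0).mono fun t ht => (hy t ht).1) ?_
      have : Tendsto (fun t : ℝ => Real.exp (t / 2) * (r / 2)) atBot (𝓝 (0 * (r / 2))) :=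
        (Real.tendsto_exp_atBot.comp (tendsto_id.atBot_div_const two_pos)).mul_const _
      simpa using this
    refine this.congr' ((eventually_le_atBot 0).mono fun t ht => ?_)
    simp [ht]
  · have : Tendsto β atTop (𝓝 q') := by
      rw [tendsto_iff_norm_sub_tendsto_zero]
      refine squeeze_zero' (Eventually.of_forall fun _ => norm_nonneg _)
        ((eventually_ge_atTop T).mono hsink) ?_
      have : Tendsto (fun t : ℝ => 5 * r / 8 * Real.exp (-((t - T) / 2))) atTop
          (𝓝 (5 * r / 8 * 0)) :=
        (Real.tendsto_exp_neg_atTop_nhds_zero.comp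
          ((tendsto_atTop_add_const_right _ (-T) tendsto_id).atTop_div_const two_pos)).const_mul _
      simpa using this
    refine this.congr' ((eventually_gt_atTop 0).mono fun t ht => ?_)
    simp [ht.not_ge]
  · simp only [le_refl, if_true]
    refine hyζ.trans (le_trans ?_ h5)
    exact le_mul_of_one_le_right (by positivity) hB

end Persistence

/-! ### Averages over a subgroup and the linear saddle. -/

section RegularRepresentation

open Set Metric

variable {G : Type*} [Group G]

theorem mem_conj {K : Subgroup G} {g b : G} : b ∈ conj K g ↔ g⁻¹ * b * g ∈ K := by
  constructor
  · rintro ⟨k, hk, rfl⟩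
    have : g⁻¹ * (g * k * g⁻¹) * g = k := by group
    simpa [this] using hk
  · intro h
    exact ⟨_, h, by simp [mul_assoc]⟩

theorem mem_isotropy {x : G → ℂ} {a : G} : a ∈ isotropy x ↔ regRep G a x = x := Iff.rfl

theorem regRep_mul_apply (a b : G) (y : G → ℂ) :
    regRep G (a * b) y = regRep G a (regRep G b y) := by
  rw [map_mul, Module.End.mul_apply]

theorem regRep_inv_self (a : G) (y : G → ℂ) : regRep G a⁻¹ (regRep G a y) = y := by
  rw [← regRep_mul_apply, inv_mul_cancel, map_one, Module.End.one_apply]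

theorem regRep_self_inv (a : G) (y : G → ℂ) : regRep G a (regRep G a⁻¹ y) = y := by
  rw [← regRep_mul_apply, mul_inv_cancel, map_one, Module.End.one_apply]

theorem regRep_real_smul (a : G) (c : ℝ) (y : G → ℂ) : regRep G a (c • y) = c • regRep G a y := rfl

theorem norm_regRep [Fintype G] (a : G) (y : G → ℂ) : ‖regRep G a y‖ = ‖y‖ := by
  have h : ∀ (a : G) (y : G → ℂ), ‖regRep G a y‖ ≤ ‖y‖ := fun a y =>
    (pi_norm_le_iff_of_nonneg (norm_nonneg _)).2 fun b => norm_le_pi_norm y (a⁻¹ * b)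
  refine (h a y).antisymm ?_
  conv_lhs => rw [← regRep_inv_self a y]
  exact h _ _

theorem continuous_regRep (a : G) : Continuous (regRep G a) :=
  continuous_pi fun b => continuous_apply (a⁻¹ * b)

/-- The real subspace of the points fixed by a subgroup. -/
def fixedSpace (S : Subgroup G) : Submodule ℝ (G → ℂ) where
  carrier := {y | ∀ a ∈ S, regRep G a y = y}
  add_mem' hy hz a ha := by rw [map_add, hy a ha, hz a ha]
  zero_mem' a _ := map_zero _
  smul_mem' c y hy a ha := by rw [regRep_real_smul, hy a ha]

theorem mem_fixedSpace {S : Subgroup G} {y : G → ℂ} :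
    y ∈ fixedSpace S ↔ ∀ a ∈ S, regRep G a y = y := Iff.rfl

theorem isClosed_fixedSpace (S : Subgroup G) : IsClosed (fixedSpace S : Set (G → ℂ)) := by
  have : (fixedSpace S : Set (G → ℂ)) = ⋂ a ∈ S, {y | regRep G a y = y} := by
    ext y; simp [mem_fixedSpace]
  rw [this]
  exact isClosed_biInter fun a _ => isClosed_eq (continuous_regRep a) continuous_id

open Classical in
/-- The average of a function over left translation by a subgroup. -/
noncomputable def average {V : Type*} [AddCommGroup V] [Module ℝ V] [Fintype G] (S : Subgroup G) :
    (G → V) →ₗ[ℝ] (G → V) where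
  toFun y b := (Nat.card S : ℝ)⁻¹ • ∑ a : G, if a ∈ S then y (a⁻¹ * b) else 0
  map_add' y z := by
    funext b
    simp only [Pi.add_apply, ← smul_add, ← Finset.sum_add_distrib]
    congr 1
    exact Finset.sum_congr rfl fun a _ => by split_ifs <;> simp
  map_smul' c y := by
    funext b
    simp only [Pi.smul_apply, RingHom.id_apply]
    rw [smul_comm c, Finset.smul_sum (r := c)]
    congr 1
    exact Finset.sum_congr rfl fun a _ => by split_ifs <;> simp

section Average

open Classical in
theorem average_apply {V : Type*} [AddCommGroup V] [Module ℝ V] [Fintype G] (S : Subgroup G)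
    (y : G → V) (b : G) :
    average S y b = (Nat.card S : ℝ)⁻¹ • ∑ a : G, if a ∈ S then y (a⁻¹ * b) else 0 := rfl

variable {V : Type*} [AddCommGroup V] [Module ℝ V] [Fintype G] {S : Subgroup G}

theorem average_eq_self {y : G → V} (hy : ∀ a ∈ S, ∀ b, y (a⁻¹ * b) = y b) : average S y = y := by
  classical
  funext b
  rw [average_apply]
  have : ∀ a : G, (if a ∈ S then y (a⁻¹ * b) else 0) = if a ∈ S then y b else 0 := fun a => by
    split_ifs with h
    · exact hy a h b
    · rfl
  simp_rw [this]
  rw [← Finset.sum_filter, Finset.sum_const, ← Nat.cast_smul_eq_nsmul ℝ, smul_smul,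
    ← Fintype.card_subtype, ← Nat.card_eq_fintype_card]
  have : (Nat.card S : ℝ) ≠ 0 := Nat.cast_ne_zero.2 Nat.card_pos.ne'
  erw [inv_mul_cancel₀ this]
  rw [one_smul]

theorem average_apply_inv_mul {a : G} (ha : a ∈ S) (y : G → V) (b : G) :
    average S y (a⁻¹ * b) = average S y b := by
  classical
  simp only [average_apply]
  congr 1
  refine Fintype.sum_equiv (Equiv.mulLeft a) _ _ fun k => ?_
  simp only [Equiv.coe_mulLeft, S.mul_mem_cancel_left ha, mul_inv_rev, mul_assoc]

theorem average_average (y : G → V) : average S (average S y) = average S y :=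
  average_eq_self fun _ ha b => average_apply_inv_mul ha y b

/-- Conjugation by `a⁻¹` permutes `S` and reindexes the sum. -/
theorem average_comp_inv_mul {a : G} (ha : a ∈ Subgroup.normalizer (S : Set G)) (y : G → V)
    (b : G) : average S (fun b => y (a⁻¹ * b)) b = average S y (a⁻¹ * b) := by
  classical
  simp only [average_apply]
  congr 1
  refine Fintype.sum_equiv (MulAut.conj a⁻¹).toEquiv _ _ fun k => ?_
  have h : k ∈ S ↔ a⁻¹ * k * a ∈ S := by
    have := Subgroup.mem_normalizer_iff.1 ha (a⁻¹ * k * a)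
    rw [this]
    simp [mul_assoc]
  simp only [MulEquiv.toEquiv_eq_coe, MulEquiv.coe_toEquiv, MulAut.conj_apply, inv_inv, ← h]
  simp [mul_assoc]

end Average

/-- The continuous projection onto the functions of average zero. -/
noncomputable def projUnstable [Fintype G] (S : Subgroup G) : (G → ℂ) →L[ℝ] (G → ℂ) :=
  1 - (average S).toContinuousLinearMap

section ProjUnstable

variable [Fintype G] {S : Subgroup G}

theorem projUnstable_apply (y : G → ℂ) : projUnstable S y = y - average S y := rfl

theorem one_sub_projUnstable_apply (y : G → ℂ) : (1 - projUnstable S) y = average S y := by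
  simp [projUnstable_apply]

theorem projUnstable_projUnstable (y : G → ℂ) :
    projUnstable S (projUnstable S y) = projUnstable S y := by
  simp [projUnstable_apply, average_average]

theorem average_of_mem_fixedSpace {y : G → ℂ} (hy : y ∈ fixedSpace S) : average S y = y :=
  average_eq_self fun a ha b => congrFun (hy a ha) b

theorem projUnstable_regRep {a : G} (ha : a ∈ Subgroup.normalizer (S : Set G)) (y : G → ℂ) :
    projUnstable S (regRep G a y) = regRep G a (projUnstable S y) := by
  rw [projUnstable_apply, projUnstable_apply, map_sub]
  congr 1
  funext b
  exact average_comp_inv_mul ha y b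

/-- The hyperbolic linear involution `P - (1 - P)`, where `P = projUnstable S`. -/
noncomputable def saddle (S : Subgroup G) : (G → ℂ) →L[ℝ] (G → ℂ) :=
  projUnstable S - (1 - projUnstable S)

theorem saddle_apply (y : G → ℂ) :
    saddle S y = projUnstable S y - (1 - projUnstable S) y := rfl

theorem saddle_of_mem_fixedSpace {y : G → ℂ} (hy : y ∈ fixedSpace S) : saddle S y = -y := by
  rw [saddle_apply, one_sub_projUnstable_apply, projUnstable_apply, average_of_mem_fixedSpace hy]
  simp

theorem saddle_saddle (y : G → ℂ) : saddle S (saddle S y) = y := by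
  simp [saddle_apply, projUnstable_apply, average_average]

theorem saddle_regRep {a : G} (ha : a ∈ Subgroup.normalizer (S : Set G)) (y : G → ℂ) :
    saddle S (regRep G a y) = regRep G a (saddle S y) := by
  simp only [saddle_apply, sub_apply, one_apply_eq_self, projUnstable_regRep ha, map_sub]

end ProjUnstable

end RegularRepresentation

/-! ### An unstable direction inside Fix(K). -/

section Profile

variable {G : Type*} [Group G] {K H : Subgroup G} {g : G}

open Classical in
/-- The indicator function of a subgroup. -/
noncomputable def indicatorFun (S : Subgroup G) (b : G) : ℝ := if b ∈ S then 1 else 0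

theorem indicatorFun_of_mem {S : Subgroup G} {b : G} (hb : b ∈ S) : indicatorFun S b = 1 :=
  if_pos hb

theorem indicatorFun_of_notMem {S : Subgroup G} {b : G} (hb : b ∉ S) : indicatorFun S b = 0 :=
  if_neg hb

theorem indicatorFun_inv_mul {S : Subgroup G} {a : G} (ha : a ∈ S) (b : G) :
    indicatorFun S (a⁻¹ * b) = indicatorFun S b := by
  have h := S.mul_mem_cancel_left (S.inv_mem ha) (y := b)
  by_cases hb : b ∈ S
  · rw [indicatorFun_of_mem hb, indicatorFun_of_mem (h.2 hb)]
  · rw [indicatorFun_of_notMem hb, indicatorFun_of_notMem (mt h.1 hb)]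

theorem indicatorFun_nonneg (S : Subgroup G) (b : G) : 0 ≤ indicatorFun S b := by
  unfold indicatorFun; split_ifs <;> norm_num

theorem indicatorFun_le_one (S : Subgroup G) (b : G) : indicatorFun S b ≤ 1 := by
  unfold indicatorFun; split_ifs <;> norm_num

theorem conj_inv_le (hT : IsHomoclinicTriple K g H) : conj K g⁻¹ ≤ H := by
  intro b hb
  rw [mem_conj, inv_inv] at hb
  simpa [mul_assoc] using mem_conj.1 (hT.ht2 hb).2

theorem notMem_normalizer (hT : IsHomoclinicTriple K g H) {h : G} (hh : h ∈ H) :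
    g * h ∉ Subgroup.normalizer (K : Set G) := fun hn =>
  (Set.eq_empty_iff_forall_notMem.1 hT.ht1 (g * h)) ⟨⟨h, hh, rfl⟩, hn⟩

theorem notMem_of_isHomoclinicTriple (hT : IsHomoclinicTriple K g H) (hL : HTL K g H) : g ∉ H :=
  fun hg => notMem_normalizer hT H.one_mem (by simpa using (hL hg).1)

/-- The two groups have equal order, so an inclusion would be an equality and `g` would normalize
`K`. -/
theorem exists_mem_conj_notMem [Finite G] (hT : IsHomoclinicTriple K g H) :
    ∃ a ∈ conj K g⁻¹, a ∉ K := by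
  by_contra! hle
  have hcard : Nat.card (conj K g⁻¹) = Nat.card K :=
    Subgroup.card_map_of_injective (MulAut.conj g⁻¹).injective
  have heq := Subgroup.eq_of_le_of_card_ge (fun a ha => hle a ha) hcard.ge
  refine notMem_normalizer hT H.one_mem (Subgroup.mem_normalizer_iff.2 fun h => ?_)
  conv_lhs => rw [← heq]
  rw [mul_one, mem_conj, inv_inv]

/-- Subtract from the indicator of `K` its `S`-average and normalize at `1`. The average is
nonnegative, which gives the sign off `K`, and is below `1` at `1` because `S` is not contained in
`K`. Invariance under `K` survives because `K ≤ H` normalizes `S`. -/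
theorem exists_profile [Fintype G] (hT : IsHomoclinicTriple K g H) (hL : HTL K g H) :
    ∃ ξ : G → ℝ, ξ 1 = 1 ∧ (∀ b, b ∉ K → ξ b ≤ 0) ∧
      (∀ k ∈ K, ∀ b, ξ (k⁻¹ * b) = ξ b) ∧ average (conj K g⁻¹) ξ = 0 := by
  classical
  set S := conj K g⁻¹
  let e := indicatorFun K
  have hKH : K ≤ H := fun k hk => (hT.ht2 hk).1
  have hcard : 0 < (Nat.card S : ℝ)⁻¹ := inv_pos.2 (Nat.cast_pos.2 Nat.card_pos)
  have hnonneg : ∀ b, 0 ≤ average S e b := fun b => by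
    rw [average_apply]
    refine smul_nonneg hcard.le (Finset.sum_nonneg fun a _ => ?_)
    split_ifs
    · exact indicatorFun_nonneg _ _
    · exact le_rfl
  have hlt : average S e 1 < 1 := by
    have h1 : average S (fun _ : G => (1 : ℝ)) 1 = 1 := by rw [average_eq_self (by simp)]
    conv_rhs => rw [← h1]
    rw [average_apply, average_apply]
    refine smul_lt_smul_of_pos_left (Finset.sum_lt_sum (fun a _ => ?_) ?_) hcard
    · split_ifs
      · exact indicatorFun_le_one _ _
      · exact le_rfl
    · obtain ⟨a, ha, haK⟩ := exists_mem_conj_notMem hT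
      refine ⟨a, Finset.mem_univ _, ?_⟩
      rw [if_pos ha, if_pos ha, mul_one]
      have : indicatorFun K a⁻¹ = 0 := indicatorFun_of_notMem (by simpa using haK)
      simp only [e, this]
      norm_num
  have hpos : 0 < 1 - average S e 1 := by linarith
  refine ⟨(1 - average S e 1)⁻¹ • (e - average S e), ?_, fun b hb => ?_,
    fun k hk b => ?_, ?_⟩
  · have : e 1 = 1 := indicatorFun_of_mem K.one_mem
    simp only [Pi.smul_apply, Pi.sub_apply, this, smul_eq_mul]
    exact inv_mul_cancel₀ hpos.ne'
  · have : e b = 0 := indicatorFun_of_notMem hb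
    simp only [Pi.smul_apply, Pi.sub_apply, this, smul_eq_mul, zero_sub]
    have := hnonneg b
    have := inv_pos.2 hpos
    nlinarith
  · have h1 : e (k⁻¹ * b) = e b := indicatorFun_inv_mul hk b
    have h2 : average S e (k⁻¹ * b) = average S e b := by
      rw [← average_comp_inv_mul (hL (hKH hk)).2]
      rw [show (fun b => e (k⁻¹ * b)) = e from funext fun b => indicatorFun_inv_mul hk b]
    simp [h1, h2]
  · rw [map_smul, map_sub, average_average, sub_self, smul_zero]

end Profile

/-! ### Parametrization and speed of the planar curve. -/

section Curve

/-- A smooth step from `0` on `(-∞, 1/2]` to `1` on `[3/4, ∞)`. -/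
noncomputable def step (τ : ℝ) : ℝ := Real.smoothTransition (4 * τ - 2)

theorem contDiff_step : ContDiff ℝ ∞ step :=
  Real.smoothTransition.contDiff.comp (by fun_prop)

theorem step_of_le {τ : ℝ} (h : τ ≤ 1 / 2) : step τ = 0 :=
  Real.smoothTransition.zero_of_nonpos (by linarith)

theorem step_of_ge {τ : ℝ} (h : 3 / 4 ≤ τ) : step τ = 1 :=
  Real.smoothTransition.one_of_one_le (by linarith)

theorem step_nonneg (τ : ℝ) : 0 ≤ step τ := Real.smoothTransition.nonneg _

theorem step_le_one (τ : ℝ) : step τ ≤ 1 := Real.smoothTransition.le_one _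

/-- The first coordinate of the planar curve that the homoclinic trajectory follows. -/
noncomputable def shift (τ : ℝ) : ℝ := step τ * (2 * τ - 1)

theorem contDiff_shift : ContDiff ℝ ∞ shift := contDiff_step.mul (by fun_prop)

theorem shift_of_le {τ : ℝ} (h : τ ≤ 1 / 2) : shift τ = 0 := by simp [shift, step_of_le h]

theorem shift_of_ge {τ : ℝ} (h : 3 / 4 ≤ τ) : shift τ = 2 * τ - 1 := by
  simp [shift, step_of_ge h]

/-- The imaginary amplitude `τ - shift τ` of the curve is thus positive away from the ends. -/
theorem shift_lt {τ : ℝ} (h0 : 0 < τ) (h1 : τ < 1) : shift τ < τ := by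
  rcases le_total τ (1 / 2) with h | h
  · rwa [shift_of_le h]
  · have := step_le_one τ
    unfold shift
    nlinarith

theorem shift_zero : shift 0 = 0 := shift_of_le (by norm_num)

theorem shift_one : shift 1 = 1 := by rw [shift_of_ge (by norm_num)]; norm_num

theorem shift_le {τ : ℝ} (h : τ ∈ Set.Icc (0 : ℝ) 1) : shift τ ≤ τ := by
  rcases h.1.eq_or_lt with rfl | h0
  · exact shift_zero.le
  rcases h.2.eq_or_lt with rfl | h1
  · exact shift_one.le
  exact (shift_lt h0 h1).le

theorem shift_le_half {τ : ℝ} (h : τ ≤ 3 / 4) : shift τ ≤ 1 / 2 := by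
  rcases le_total τ (1 / 2) with h' | h'
  · rw [shift_of_le h']; norm_num
  · have := step_le_one τ
    unfold shift
    nlinarith

theorem deriv_shift_of_lt {τ : ℝ} (h : τ < 1 / 2) : deriv shift τ = 0 := by
  have : shift =ᶠ[𝓝 τ] fun _ => 0 := by
    filter_upwards [Iio_mem_nhds h] with s hs using shift_of_le (le_of_lt hs)
  rw [this.deriv_eq, deriv_const]

theorem deriv_shift_of_gt {τ : ℝ} (h : 3 / 4 < τ) : deriv shift τ = 2 := by
  have : shift =ᶠ[𝓝 τ] fun τ => 2 * τ - 1 := by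
    filter_upwards [Ioi_mem_nhds h] with s hs using shift_of_ge (le_of_lt hs)
  rw [this.deriv_eq]
  have : HasDerivAt (fun τ : ℝ => 2 * τ - 1) (2 * 1) τ :=
    ((hasDerivAt_id τ).const_mul 2).sub_const 1
  simp [this.deriv]

/-- The speed along the curve. -/
noncomputable def speed (τ : ℝ) : ℝ := (1 - step τ) * τ + step τ * (1 - τ)

theorem contDiff_speed : ContDiff ℝ ∞ speed := by
  have := contDiff_step
  unfold speed
  fun_prop

theorem speed_of_le {τ : ℝ} (h : τ ≤ 1 / 2) : speed τ = τ := by simp [speed, step_of_le h]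

theorem speed_of_ge {τ : ℝ} (h : 3 / 4 ≤ τ) : speed τ = 1 - τ := by simp [speed, step_of_ge h]

/-- `speed` is a convex combination of `τ` and `1 - τ`, so the motion does not stall before the
ends. -/
theorem min_le_speed (τ : ℝ) : min τ (1 - τ) ≤ speed τ := by
  have h0 := step_nonneg τ
  have h1 := step_le_one τ
  unfold speed
  nlinarith [min_le_left τ (1 - τ), min_le_right τ (1 - τ)]

end Curve

/-! ### The connecting curve in the representation. -/

section GroupCurve

open Set Metric

variable {G : Type*} [Group G]

/-- The equilibrium: the indicator function of `H`. -/
noncomputable def basePoint (H : Subgroup G) : G → ℂ := fun b => (indicatorFun H b : ℂ)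

/-- The purely imaginary function with imaginary part `ξ`. -/
noncomputable def imagDir (ξ : G → ℝ) : G → ℂ := fun b => (ξ b : ℂ) * Complex.I

/-- A curve from `basePoint H` to its translate by `g`. -/
noncomputable def curve (H : Subgroup G) (g : G) (ξ : G → ℝ) (τ : ℝ) : G → ℂ :=
  basePoint H + shift τ • (regRep G g (basePoint H) - basePoint H) + (τ - shift τ) • imagDir ξ

/-- The velocity along `curve`. -/
noncomputable def velocity (H : Subgroup G) (g : G) (ξ : G → ℝ) (τ : ℝ) : G → ℂ :=
  speed τ • (deriv shift τ • (regRep G g (basePoint H) - basePoint H) +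
    (1 - deriv shift τ) • imagDir ξ)

/-- A linear form that restricts to the parameter on `curve`. -/
noncomputable def parameter (g : G) (y : G → ℂ) : ℝ := (y g).re + (y 1).im

variable {K H : Subgroup G} {g : G} {ξ : G → ℝ}

theorem curve_apply (τ : ℝ) (b : G) : curve H g ξ τ b =
    (((1 - shift τ) * indicatorFun H b + shift τ * indicatorFun H (g⁻¹ * b) : ℝ) : ℂ) +
      (((τ - shift τ) * ξ b : ℝ) : ℂ) * Complex.I := by
  simp only [curve, basePoint, imagDir, Pi.add_apply, Pi.smul_apply, Pi.sub_apply, regRep_apply,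
    Complex.real_smul]
  push_cast
  ring

theorem curve_re (τ : ℝ) (b : G) : (curve H g ξ τ b).re =
    (1 - shift τ) * indicatorFun H b + shift τ * indicatorFun H (g⁻¹ * b) := by
  simp [curve_apply]

theorem curve_im (τ : ℝ) (b : G) : (curve H g ξ τ b).im = (τ - shift τ) * ξ b := by
  simp [curve_apply]

theorem curve_zero : curve H g ξ 0 = basePoint H := by simp [curve, shift_zero]

theorem curve_one : curve H g ξ 1 = regRep G g (basePoint H) := by simp [curve, shift_one]

theorem parameter_curve (hg : g ∉ H) (hξ : ξ 1 = 1) (τ : ℝ) : parameter g (curve H g ξ τ) = τ := by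
  rw [parameter, curve_re, curve_im, hξ, indicatorFun_of_notMem hg, inv_mul_cancel,
    indicatorFun_of_mem H.one_mem]
  ring

theorem hasDerivAt_curve [Fintype G] (τ : ℝ) : HasDerivAt (curve H g ξ)
    (deriv shift τ • (regRep G g (basePoint H) - basePoint H) +
      (1 - deriv shift τ) • imagDir ξ) τ := by
  have h : HasDerivAt shift (deriv shift τ) τ :=
    (contDiff_shift.differentiable (by simp) τ).hasDerivAt
  exact ((h.smul_const (regRep G g (basePoint H) - basePoint H)).const_add (basePoint H)).add
    (((hasDerivAt_id τ).sub h).smul_const (imagDir ξ))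

theorem contDiff_velocity [Fintype G] : ContDiff ℝ ∞ (velocity H g ξ) := by
  have h1 := contDiff_speed
  have h2 : ContDiff ℝ ∞ (deriv shift) := contDiff_shift.deriv'
  unfold velocity
  fun_prop

theorem regRep_basePoint {a : G} (ha : a ∈ H) : regRep G a (basePoint H) = basePoint H := by
  funext b
  simp only [regRep_apply, basePoint, indicatorFun_inv_mul ha]

theorem mem_of_norm_regRep_basePoint_sub_lt [Fintype G] {a : G}
    (h : ‖regRep G a (basePoint H) - basePoint H‖ < 1) : a ∈ H := by
  by_contra ha
  have h1 := (norm_le_pi_norm (regRep G a (basePoint H) - basePoint H) a).trans_lt h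
  simp [regRep_apply, basePoint, indicatorFun_of_mem H.one_mem, indicatorFun_of_notMem ha] at h1

theorem basePoint_mem_fixedSpace (hT : IsHomoclinicTriple K g H) :
    basePoint H ∈ fixedSpace K := fun _ ha => regRep_basePoint (hT.ht2 ha).1

theorem regRep_basePoint_mem_fixedSpace (hT : IsHomoclinicTriple K g H) :
    regRep G g (basePoint H) ∈ fixedSpace K := fun a ha => by
  have h := mem_conj.1 (hT.ht2 ha).2
  rw [← regRep_mul_apply, show a * g = g * (g⁻¹ * a * g) by group, regRep_mul_apply,
    regRep_basePoint h]

theorem imagDir_mem_fixedSpace (hξ : ∀ k ∈ K, ∀ b, ξ (k⁻¹ * b) = ξ b) :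
    imagDir ξ ∈ fixedSpace K := fun a ha => by
  funext b
  simp only [regRep_apply, imagDir, hξ a ha]

theorem curve_mem_fixedSpace (hT : IsHomoclinicTriple K g H)
    (hξ : ∀ k ∈ K, ∀ b, ξ (k⁻¹ * b) = ξ b) (τ : ℝ) : curve H g ξ τ ∈ fixedSpace K := by
  have h1 := basePoint_mem_fixedSpace hT
  have h2 := regRep_basePoint_mem_fixedSpace hT
  have h3 := imagDir_mem_fixedSpace hξ
  exact add_mem (add_mem h1 (Submodule.smul_mem _ _ (sub_mem h2 h1))) (Submodule.smul_mem _ _ h3)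

theorem velocity_mem_fixedSpace (hT : IsHomoclinicTriple K g H)
    (hξ : ∀ k ∈ K, ∀ b, ξ (k⁻¹ * b) = ξ b) (τ : ℝ) : velocity H g ξ τ ∈ fixedSpace K := by
  have h1 := basePoint_mem_fixedSpace hT
  have h2 := regRep_basePoint_mem_fixedSpace hT
  have h3 := imagDir_mem_fixedSpace hξ
  exact Submodule.smul_mem _ _ (add_mem (Submodule.smul_mem _ _ (sub_mem h2 h1))
    (Submodule.smul_mem _ _ h3))

theorem average_imagDir [Fintype G] {S : Subgroup G} (hξ : average S ξ = 0) :
    average S (imagDir ξ) = 0 := by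
  classical
  funext b
  have h := congrFun hξ b
  have hcard : (Nat.card S : ℝ)⁻¹ ≠ 0 := inv_ne_zero (Nat.cast_ne_zero.2 Nat.card_pos.ne')
  rw [average_apply, Pi.zero_apply, smul_eq_zero_iff_right hcard] at h
  rw [average_apply, Pi.zero_apply, smul_eq_zero_iff_right hcard]
  calc _ = ((∑ a : G, if a ∈ S then ξ (a⁻¹ * b) else 0 : ℝ) : ℂ) * Complex.I := by
        rw [Complex.ofReal_sum, Finset.sum_mul]
        exact Finset.sum_congr rfl fun a _ => by split_ifs <;> simp [imagDir]
    _ = 0 := by rw [h]; simp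

/-- Compare imaginary parts at `a`: the translated curve is positive there, while `ξ a ≤ 0` if `a ∉
K`. -/
theorem mem_of_regRep_curve_eq (hξ1 : ξ 1 = 1) (hξK : ∀ b, b ∉ K → ξ b ≤ 0) {a : G} {τ σ : ℝ}
    (hτ : τ ∈ Ioo (0 : ℝ) 1) (hσ : σ ∈ Icc (0 : ℝ) 1)
    (h : regRep G a (curve H g ξ τ) = curve H g ξ σ) : a ∈ K := by
  by_contra ha
  have h1 := congrArg Complex.im (congrFun h a)
  rw [regRep_apply, inv_mul_cancel, curve_im, curve_im, hξ1] at h1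
  nlinarith [shift_lt hτ.1 hτ.2, shift_le hσ, hξK a ha]

/-- The curve comes near the orbit of the equilibrium only at its ends, where the velocity is the
linear one. The imaginary part at `1` and the real part at `g`, `1` or `a` decide each case. -/
theorem mem_and_lt_of_norm_curve_sub_lt [Fintype G] (hg : g ∉ H) (hξ1 : ξ 1 = 1)
    {a : G} {τ : ℝ} (h : ‖curve H g ξ τ - regRep G a (basePoint H)‖ < 1 / 8) :
    (a ∈ H ∧ τ < 1 / 2) ∨ (g⁻¹ * a ∈ H ∧ 3 / 4 < τ) := by
  have hb : ∀ b, ‖curve H g ξ τ b - (indicatorFun H (a⁻¹ * b) : ℂ)‖ < 1 / 8 := fun b =>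
    (norm_le_pi_norm (curve H g ξ τ - regRep G a (basePoint H)) b).trans_lt h
  have hre : ∀ b, |(1 - shift τ) * indicatorFun H b + shift τ * indicatorFun H (g⁻¹ * b) -
      indicatorFun H (a⁻¹ * b)| < 1 / 8 := fun b => by
    have := (Complex.abs_re_le_norm _).trans_lt (hb b)
    rwa [Complex.sub_re, curve_re, Complex.ofReal_re] at this
  have him : ∀ b, |(τ - shift τ) * ξ b| < 1 / 8 := fun b => by
    have := (Complex.abs_im_le_norm _).trans_lt (hb b)
    rwa [Complex.sub_im, curve_im, Complex.ofReal_im, sub_zero] at this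
  have h1 := abs_lt.1 (him 1)
  rw [hξ1] at h1
  have hginv : g⁻¹ ∉ H := by simpa using hg
  by_cases ha : a ∈ H
  · refine Or.inl ⟨ha, ?_⟩
    have h2 := abs_lt.1 (hre g)
    have hag : a⁻¹ * g ∉ H := fun hm => hg ((H.mul_mem_cancel_left (H.inv_mem ha)).1 hm)
    rw [indicatorFun_of_notMem hg, inv_mul_cancel, indicatorFun_of_mem H.one_mem,
      indicatorFun_of_notMem hag] at h2
    by_contra! hle
    rcases le_total τ (3 / 4) with h3 | h3
    · linarith
    · rw [shift_of_ge h3] at h2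
      linarith
  · by_cases hga : g⁻¹ * a ∈ H
    · refine Or.inr ⟨hga, ?_⟩
      have h2 := abs_lt.1 (hre 1)
      have ha' : a⁻¹ * 1 ∉ H := by simpa using ha
      rw [indicatorFun_of_notMem ha', mul_one, indicatorFun_of_notMem hginv,
        indicatorFun_of_mem H.one_mem] at h2
      by_contra! hle
      linarith [shift_le_half hle]
    · have h2 := abs_lt.1 (hre a)
      rw [indicatorFun_of_notMem ha, indicatorFun_of_notMem hga, inv_mul_cancel,
        indicatorFun_of_mem H.one_mem] at h2
      linarith

theorem velocity_of_lt {τ : ℝ} (h : τ < 1 / 2) : velocity H g ξ τ = τ • imagDir ξ := by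
  rw [velocity, speed_of_le h.le, deriv_shift_of_lt h]
  simp

theorem curve_sub_of_le {τ : ℝ} (h : τ ≤ 1 / 2) :
    curve H g ξ τ - basePoint H = τ • imagDir ξ := by
  simp [curve, shift_of_le h]

theorem velocity_of_gt {τ : ℝ} (h : 3 / 4 < τ) :
    velocity H g ξ τ = -(curve H g ξ τ - regRep G g (basePoint H)) := by
  rw [velocity, speed_of_ge h.le, deriv_shift_of_gt h, curve, shift_of_ge h.le]
  module

theorem saddle_curve_sub [Fintype G] {S : Subgroup G} (hξ : average S ξ = 0) {τ : ℝ}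
    (h : τ < 1 / 2) : saddle S (curve H g ξ τ - basePoint H) = velocity H g ξ τ := by
  rw [curve_sub_of_le h.le, velocity_of_lt h, map_smul, saddle_apply, one_sub_projUnstable_apply,
    projUnstable_apply, average_imagDir hξ, sub_zero, sub_zero]

theorem regRep_inv_mem_fixedSpace {y : G → ℂ} (hy : y ∈ fixedSpace K) :
    regRep G g⁻¹ y ∈ fixedSpace (conj K g⁻¹) := fun a ha => by
  rw [mem_conj, inv_inv] at ha
  rw [← regRep_mul_apply, show a * g⁻¹ = g⁻¹ * (g * a * g⁻¹) by group, regRep_mul_apply, hy _ ha]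

end GroupCurve

/-! ### The smooth equivariant model field. -/

section Field

open Set Metric
open scoped Manifold

variable {G : Type*} [Group G] [Fintype G] {K H : Subgroup G} {g : G} {ξ : G → ℝ}

theorem continuous_curve : Continuous (curve H g ξ) :=
  continuous_iff_continuousAt.2 fun τ => (hasDerivAt_curve τ).continuousAt

theorem contDiff_regRep (a : G) {n : ℕ∞ω} : ContDiff ℝ n (regRep G a) :=
  contDiff_pi.2 fun b => contDiff_apply ℝ ℂ (a⁻¹ * b)

/-- Since `g⁻¹` maps Fix(K) into the stable space Fix(S), the saddle transported to `g · x₀` is a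
sink inside Fix(K). -/
theorem regRep_saddle_of_mem_fixedSpace {y : G → ℂ} (hy : y ∈ fixedSpace K) :
    regRep G g (saddle (conj K g⁻¹) (regRep G g⁻¹ y)) = -y := by
  rw [saddle_of_mem_fixedSpace (regRep_inv_mem_fixedSpace hy), map_neg, regRep_self_inv]

/-- The values prescribed for the vector field: the linear saddle near the equilibrium and the
velocity along the curve. -/
def IsPrescribed (K H : Subgroup G) (g : G) (ξ : G → ℝ) (y u : G → ℂ) : Prop :=
  (y ∈ closedBall (basePoint H) (1 / 16) → u = saddle (conj K g⁻¹) (y - basePoint H)) ∧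
    ∀ τ ∈ Icc (0 : ℝ) 1, y = curve H g ξ τ → u = velocity H g ξ τ

theorem convex_isPrescribed (y : G → ℂ) : Convex ℝ {u | IsPrescribed K H g ξ y u} := by
  intro u hu v hv a b _ _ hab
  refine ⟨fun h => ?_, fun τ hτ h => ?_⟩
  · rw [hu.1 h, hv.1 h, ← add_smul, hab, one_smul]
  · rw [hu.2 τ hτ h, hv.2 τ hτ h, ← add_smul, hab, one_smul]

/-- Constraining all translates at once is what lets the symmetrized field keep the prescribed
values; convexity is what the partition of unity needs. -/
theorem convex_forall_isPrescribed (y : G → ℂ) :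
    Convex ℝ {u | ∀ a : G, IsPrescribed K H g ξ (regRep G a y) (regRep G a u)} := by
  intro u hu v hv b c hb hc hbc a
  rw [map_add, regRep_real_smul, regRep_real_smul]
  exact convex_isPrescribed _ (hu a) (hv a) hb hc hbc

/-- A translate that returns near `x₀` comes from `H`, which commutes with the saddle. A translate
on the curve comes from `H` or from `g H`, and then the velocity is the saddle at `x₀` or the sink
at `g · x₀`. -/
theorem isPrescribed_saddle (hT : IsHomoclinicTriple K g H) (hL : HTL K g H) (hξ1 : ξ 1 = 1)
    (hξK : ∀ k ∈ K, ∀ b, ξ (k⁻¹ * b) = ξ b) (hξ : average (conj K g⁻¹) ξ = 0) {y : G → ℂ}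
    (hy : y ∈ ball (basePoint H) (1 / 8)) (h : G) :
    IsPrescribed K H g ξ (regRep G h y)
      (regRep G h (saddle (conj K g⁻¹) (y - basePoint H))) := by
  have hg := notMem_of_isHomoclinicTriple hT hL
  rw [mem_ball, dist_eq_norm] at hy
  have hhy : ‖regRep G h y - regRep G h (basePoint H)‖ < 1 / 8 := by
    rwa [← map_sub, norm_regRep]
  refine ⟨fun hc => ?_, fun τ hτ hc => ?_⟩
  · rw [mem_closedBall, dist_eq_norm] at hc
    have hh : h ∈ H := by
      refine mem_of_norm_regRep_basePoint_sub_lt ?_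
      calc ‖regRep G h (basePoint H) - basePoint H‖ =
          ‖(regRep G h y - basePoint H) - (regRep G h y - regRep G h (basePoint H))‖ := by
            congr 1; abel
        _ ≤ 1 / 16 + 1 / 8 := (norm_sub_le _ _).trans (add_le_add hc hhy.le)
        _ < 1 := by norm_num
    rw [← saddle_regRep (hL hh).2, map_sub, regRep_basePoint hh]
  · rw [hc] at hhy
    rcases mem_and_lt_of_norm_curve_sub_lt hg hξ1 hhy with ⟨hh, hτ'⟩ | ⟨hh, hτ'⟩
    · rw [← saddle_regRep (hL hh).2, map_sub, regRep_basePoint hh, hc, saddle_curve_sub hξ hτ']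
    · have hmem : curve H g ξ τ - regRep G g (basePoint H) ∈ fixedSpace K :=
        sub_mem (curve_mem_fixedSpace hT hξK τ) (regRep_basePoint_mem_fixedSpace hT)
      have hmul : ∀ z, regRep G h z = regRep G g (regRep G (g⁻¹ * h) z) := fun z => by
        rw [← regRep_mul_apply, mul_inv_cancel_left]
      rw [velocity_of_gt hτ', ← regRep_saddle_of_mem_fixedSpace (g := g) hmem,
        map_sub (regRep G g⁻¹), regRep_inv_self, ← hc, ← regRep_mul_apply, hmul,
        ← saddle_regRep (hL hh).2, map_sub (regRep G (g⁻¹ * h)), regRep_basePoint hh]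

/-- Three local models: the translated saddle near the orbit of `x₀`, the velocity read through
`parameter` near the rest of the translated curves, and zero elsewhere. -/
theorem exists_nhds_isPrescribed (hT : IsHomoclinicTriple K g H) (hL : HTL K g H)
    (hξ1 : ξ 1 = 1) (hξ0 : ∀ b, b ∉ K → ξ b ≤ 0) (hξK : ∀ k ∈ K, ∀ b, ξ (k⁻¹ * b) = ξ b)
    (hξ : average (conj K g⁻¹) ξ = 0) (y₀ : G → ℂ) :
    ∃ U ∈ 𝓝 y₀, ∃ s : (G → ℂ) → (G → ℂ), ContDiff ℝ ∞ s ∧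
      ∀ y ∈ U, ∀ a : G, IsPrescribed K H g ξ (regRep G a y) (regRep G a (s y)) := by
  have hg := notMem_of_isHomoclinicTriple hT hL
  by_cases hball : ∃ a : G, regRep G a y₀ ∈ closedBall (basePoint H) (1 / 16)
  · obtain ⟨a, ha⟩ := hball
    refine ⟨regRep G a ⁻¹' ball (basePoint H) (1 / 8), ?_,
      fun y => regRep G a⁻¹ (saddle (conj K g⁻¹) (regRep G a y - basePoint H)), ?_,
      fun y hy b => ?_⟩
    · exact (isOpen_ball.preimage (continuous_regRep a)).mem_nhds
        (closedBall_subset_ball (by norm_num) ha)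
    · exact (contDiff_regRep _).comp ((saddle _).contDiff.comp
        ((contDiff_regRep a).sub contDiff_const))
    · have := isPrescribed_saddle hT hL hξ1 hξK hξ hy (b * a⁻¹)
      rwa [← regRep_mul_apply, inv_mul_cancel_right, regRep_mul_apply b a⁻¹] at this
  push Not at hball
  have hU₁ : {y | ∀ a : G, regRep G a y ∉ closedBall (basePoint H) (1 / 16)} ∈ 𝓝 y₀ := by
    have : IsOpen {y | ∀ a : G, regRep G a y ∉ closedBall (basePoint H) (1 / 16)} := by
      simp only [ofPred_forall]
      exact isOpen_iInter_of_finite fun a =>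
        (isClosed_closedBall.isOpen_compl).preimage (continuous_regRep a)
    exact this.mem_nhds hball
  have hC : IsClosed (curve H g ξ '' Icc 0 1) :=
    (isCompact_Icc.image continuous_curve).isClosed
  by_cases hcurve : ∃ a : G, regRep G a y₀ ∈ curve H g ξ '' Icc 0 1
  · obtain ⟨a, τ₀, hτ₀, ha⟩ := hcurve
    have hτ₀' : τ₀ ∈ Ioo (0 : ℝ) 1 := by
      refine ⟨hτ₀.1.lt_of_ne fun h => hball a ?_, hτ₀.2.lt_of_ne fun h => hball (g⁻¹ * a) ?_⟩
      · rw [← ha, ← h, curve_zero]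
        exact mem_closedBall_self (by norm_num)
      · rw [regRep_mul_apply, ← ha, h, curve_one, regRep_inv_self]
        exact mem_closedBall_self (by norm_num)
    -- Near an interior point of the curve only elements of `K` can map a point to the curve, and
    -- they fix the curve and its velocity pointwise.
    have hU₂ : {y | ∀ b : G, b ∉ K → regRep G (b * a) y ∉ curve H g ξ '' Icc 0 1} ∈ 𝓝 y₀ := by
      have : IsOpen {y | ∀ b : G, b ∉ K → regRep G (b * a) y ∉ curve H g ξ '' Icc 0 1} := by
        simp only [ofPred_forall]
        exact isOpen_iInter_of_finite fun b => isOpen_iInter_of_finite fun _ =>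
          hC.isOpen_compl.preimage (continuous_regRep _)
      refine this.mem_nhds fun b hb => ?_
      rintro ⟨σ, hσ, h⟩
      rw [regRep_mul_apply, ← ha] at h
      exact hb (mem_of_regRep_curve_eq hξ1 hξ0 hτ₀' hσ h.symm)
    refine ⟨_, inter_mem hU₁ hU₂,
      fun y => regRep G a⁻¹ (velocity H g ξ (parameter g (regRep G a y))), ?_,
      fun y hy b => ⟨fun h => absurd h (hy.1 b), fun τ hτ h => ?_⟩⟩
    · have h1 := contDiff_regRep a (n := ∞)
      have h2 : ContDiff ℝ ∞ fun y => parameter g (regRep G a y) :=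
        (Complex.reCLM.contDiff.comp ((contDiff_apply ℝ ℂ g).comp h1)).add
          (Complex.imCLM.contDiff.comp ((contDiff_apply ℝ ℂ 1).comp h1))
      exact (contDiff_regRep _).comp (contDiff_velocity.comp h2)
    · have hb : b * a⁻¹ ∈ K := by
        by_contra hb
        exact hy.2 _ hb ⟨τ, hτ, by rw [inv_mul_cancel_right, h]⟩
      have hab : regRep G a y = curve H g ξ τ := by
        rw [show a = (b * a⁻¹)⁻¹ * b by group, regRep_mul_apply, h]
        exact curve_mem_fixedSpace hT hξK τ _ (K.inv_mem hb)
      rw [← regRep_mul_apply, hab, parameter_curve hg hξ1]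
      exact velocity_mem_fixedSpace hT hξK τ _ hb
  · push Not at hcurve
    have hU₂ : {y | ∀ a : G, regRep G a y ∉ curve H g ξ '' Icc 0 1} ∈ 𝓝 y₀ := by
      have : IsOpen {y | ∀ a : G, regRep G a y ∉ curve H g ξ '' Icc 0 1} := by
        simp only [ofPred_forall]
        exact isOpen_iInter_of_finite fun b => hC.isOpen_compl.preimage (continuous_regRep _)
      exact this.mem_nhds hcurve
    exact ⟨_, inter_mem hU₁ hU₂, fun _ => 0, contDiff_const, fun y hy b =>
      ⟨fun h => absurd h (hy.1 b), fun τ hτ h => absurd ⟨τ, hτ, h.symm⟩ (hy.2 b)⟩⟩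

/-- A smooth equivariant vector field with the prescribed values. -/
theorem exists_equivariantVF (hT : IsHomoclinicTriple K g H) (hL : HTL K g H)
    (hξ1 : ξ 1 = 1) (hξ0 : ∀ b, b ∉ K → ξ b ≤ 0) (hξK : ∀ k ∈ K, ∀ b, ξ (k⁻¹ * b) = ξ b)
    (hξ : average (conj K g⁻¹) ξ = 0) :
    ∃ v : EquivariantVF G, ContDiff ℝ ∞ v.toFun ∧
      (∀ y ∈ closedBall (basePoint H) (1 / 16),
        v.toFun y = saddle (conj K g⁻¹) (y - basePoint H)) ∧
      ∀ τ ∈ Icc (0 : ℝ) 1, v.toFun (curve H g ξ τ) = velocity H g ξ τ := by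
  obtain ⟨F, hF⟩ := exists_contMDiffMap_forall_mem_convex_of_local (n := ⊤) 𝓘(ℝ, G → ℂ)
    (t := fun y => {u | ∀ a : G, IsPrescribed K H g ξ (regRep G a y) (regRep G a u)})
    convex_forall_isPrescribed fun y₀ => by
      obtain ⟨U, hU, s, hs, hsU⟩ := exists_nhds_isPrescribed hT hL hξ1 hξ0 hξK hξ y₀
      exact ⟨U, hU, s, hs.contMDiff.contMDiffOn, hsU⟩
  have hFs : ContDiff ℝ ∞ F := F.contMDiff.contDiff
  -- An equivariant map into the regular representation is determined by its coordinate at `1`,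
  -- which may be an arbitrary function. This symmetrizes `F` without averaging.
  have hv : ContDiff ℝ ∞ fun (y : G → ℂ) (a : G) => F (regRep G a⁻¹ y) 1 :=
    contDiff_pi.2 fun a => (contDiff_apply ℝ ℂ 1).comp (hFs.comp (contDiff_regRep a⁻¹))
  have hval : ∀ (y : G → ℂ) (a : G), F (regRep G a⁻¹ y) 1 = regRep G a (F (regRep G a⁻¹ y)) a :=
    fun y a => by rw [regRep_apply, inv_mul_cancel]
  refine ⟨⟨fun y a => F (regRep G a⁻¹ y) 1, hv.of_le (by exact_mod_cast le_top), fun a y => ?_⟩,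
    hv, fun y hy => ?_, fun τ hτ => ?_⟩
  · funext b
    rw [regRep_apply, ← regRep_mul_apply]
    show F (regRep G (b⁻¹ * a) y) 1 = F (regRep G (a⁻¹ * b)⁻¹ y) 1
    rw [mul_inv_rev, inv_inv]
  · funext a
    have h := hF (regRep G a⁻¹ y) a
    rw [regRep_self_inv] at h
    show F (regRep G a⁻¹ y) 1 = _
    rw [hval, h.1 hy]
  · funext a
    have h := hF (regRep G a⁻¹ (curve H g ξ τ)) a
    rw [regRep_self_inv] at h
    show F (regRep G a⁻¹ (curve H g ξ τ)) 1 = _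
    rw [hval, h.2 τ hτ rfl]

end Field

/-! ### Uniqueness, hyperbolicity and persistence of the equilibrium. -/

section Perturbation

open Set Metric
open scoped NNReal

/-- Uniqueness of the global trajectories of a `C¹` field. -/
theorem trajectory_unique {E : Type*} [NormedAddCommGroup E] [NormedSpace ℝ E]
    [FiniteDimensional ℝ E] {w : E → E} (hw : ContDiff ℝ 1 w) {α β : ℝ → E}
    (hα : ∀ t, HasDerivAt α (w (α t)) t) (hβ : ∀ t, HasDerivAt β (w (β t)) t) {t₀ : ℝ}
    (h₀ : α t₀ = β t₀) : α = β := by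
  funext t
  have hαc : Continuous α := continuous_iff_continuousAt.2 fun t => (hα t).continuousAt
  have hβc : Continuous β := continuous_iff_continuousAt.2 fun t => (hβ t).continuousAt
  set a := min t₀ t - 1
  set b := max t₀ t + 1
  obtain ⟨C₁, hC₁⟩ := (isCompact_Icc (a := a) (b := b)).exists_bound_of_continuousOn hαc.continuousOn
  obtain ⟨C₂, hC₂⟩ := (isCompact_Icc (a := a) (b := b)).exists_bound_of_continuousOn hβc.continuousOn
  obtain ⟨w', K, -, hK, -, hw'⟩ := exists_lipschitzWith_eqOn_closedBall hw (max C₁ C₂)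
  have h1 := min_le_left t₀ t
  have h2 := min_le_right t₀ t
  have h3 := le_max_left t₀ t
  have h4 := le_max_right t₀ t
  refine ODE_solution_unique_of_mem_Ioo (v := fun _ => w') (s := fun _ => univ) (K := K) (t₀ := t₀)
    (a := a) (b := b) (fun _ _ => hK.lipschitzOnWith) ⟨by linarith, by linarith⟩
    (fun s hs => ⟨?_, mem_univ _⟩) (fun s hs => ⟨?_, mem_univ _⟩) h₀ ⟨by linarith, by linarith⟩
  · have := hC₁ s (Ioo_subset_Icc_self hs)
    simpa [hw' (mem_closedBall_zero_iff.2 (this.trans (le_max_left _ _)))] using hα s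
  · have := hC₂ s (Ioo_subset_Icc_self hs)
    simpa [hw' (mem_closedBall_zero_iff.2 (this.trans (le_max_right _ _)))] using hβ s

theorem exists_speed_trajectory {τ₀ τ₁ : ℝ} (h0 : 0 < τ₀) (h01 : τ₀ ≤ τ₁) (h1 : τ₁ < 1) :
    ∃ (T : ℝ) (θ : ℝ → ℝ), 0 ≤ T ∧ θ 0 = τ₀ ∧ θ T = τ₁ ∧
      ∀ t ∈ Icc 0 T, θ t ∈ Icc τ₀ τ₁ ∧ HasDerivAt θ (speed (θ t)) t := by
  obtain ⟨w, K, L, hK, hL, hw⟩ :=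
    exists_lipschitzWith_eqOn_closedBall (contDiff_speed.of_le (by exact_mod_cast le_top)) 1
  let m := min τ₀ (1 - τ₁)
  have hm : 0 < m := lt_min h0 (by linarith)
  -- Clamping keeps the speed at least `m`, so `τ₁` is reached by time `(τ₁ - τ₀) / m`. Up to the
  -- time it is reached, the clamp has no effect.
  let clamp : ℝ → ℝ := fun τ => max τ₀ (min τ₁ τ)
  have hclamp : ∀ τ, clamp τ ∈ Icc τ₀ τ₁ := fun τ =>
    ⟨le_max_left _ _, max_le h01 (min_le_left _ _)⟩
  have hspeed : ∀ τ ∈ Icc τ₀ τ₁, w τ = speed τ := fun τ hτ => by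
    refine hw ?_
    rw [mem_closedBall_zero_iff, Real.norm_eq_abs, abs_le]
    constructor <;> linarith [hτ.1, hτ.2]
  have hlow : ∀ τ, m ≤ w (clamp τ) := fun τ => by
    rw [hspeed _ (hclamp τ)]
    exact (min_le_min (hclamp τ).1 (by linarith [(hclamp τ).2])).trans (min_le_speed _)
  have hlip : LipschitzWith K (w ∘ clamp) := by
    simpa using hK.comp ((LipschitzWith.id.const_min τ₁).const_max τ₀)
  obtain ⟨θ, hθ0, hθ⟩ := exists_forall_hasDerivAt_of_lipschitzWith hlip (fun τ => hL (clamp τ)) τ₀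
  have hcont : Continuous θ := continuous_iff_continuousAt.2 fun t => (hθ t).continuousAt
  have hmono : Monotone θ := monotone_of_deriv_nonneg (fun t => (hθ t).differentiableAt) fun t => by
    rw [(hθ t).deriv]
    exact hm.le.trans (hlow _)
  have hmono' : Monotone fun t => θ t - m * t :=
    monotone_of_deriv_nonneg (fun t => ((hθ t).sub ((hasDerivAt_id t).const_mul m)).differentiableAt)
      fun t => by
        have := ((hθ t).sub ((hasDerivAt_id t).const_mul m)).deriv
        simp only [id] at this
        erw [this]
        have := hlow (θ t)
        simp only [Function.comp_apply, mul_one]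
        linarith
  have hT' : 0 ≤ (τ₁ - τ₀) / m := div_nonneg (by linarith) hm.le
  have hreach : τ₁ ≤ θ ((τ₁ - τ₀) / m) := by
    have := hmono' hT'
    simp only [hθ0, mul_zero, sub_zero] at this
    rw [mul_div_cancel₀ _ hm.ne'] at this
    linarith
  obtain ⟨T, hT, hTτ⟩ := intermediate_value_Icc hT' hcont.continuousOn
    (show τ₁ ∈ Icc (θ 0) (θ ((τ₁ - τ₀) / m)) from ⟨by rw [hθ0]; exact h01, hreach⟩)
  refine ⟨T, θ, hT.1, hθ0, hTτ, fun t ht => ?_⟩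
  have hmem : θ t ∈ Icc τ₀ τ₁ := ⟨by rw [← hθ0]; exact hmono ht.1, by rw [← hTτ]; exact hmono ht.2⟩
  refine ⟨hmem, ?_⟩
  have hc : clamp (θ t) = θ t := by simp only [clamp, min_eq_right hmem.2, max_eq_right hmem.1]
  simpa [hc, hspeed _ hmem] using hθ t

/-- A real endomorphism whose square is close to the identity has no purely imaginary
eigenvalue. -/
theorem re_ne_zero_of_aeval_charpoly {E : Type*} [NormedAddCommGroup E] [NormedSpace ℝ E]
    [FiniteDimensional ℝ E] {L : E →ₗ[ℝ] E} (hL : ∀ y ≠ 0, ‖L (L y) - y‖ < ‖y‖) {z : ℂ}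
    (hz : Polynomial.aeval z L.charpoly = 0) : z.re ≠ 0 := by
  intro hre
  let b := Module.finBasis ℝ E
  let A := LinearMap.toMatrix b b L
  let Ac := A.map (algebraMap ℝ ℂ)
  have hz2 : z * z = ((-(z.im * z.im) : ℝ) : ℂ) := by
    apply Complex.ext <;> simp [hre]
  have hdet : (Matrix.scalar _ z - Ac).det = 0 := by
    rw [← Matrix.eval_charpoly, Matrix.charpoly_map, Polynomial.eval_map_algebraMap,
      LinearMap.charpoly_toMatrix]
    exact hz
  -- For `z = i ω` the product is the real matrix `-ω² - A²`. Its singularity gives a real `y ≠ 0`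
  -- with `L² y = -ω² y`, so `‖L² y - y‖ = (1 + ω²) ‖y‖`, which is too large.
  have hprod : (Matrix.scalar _ z - Ac) * (Matrix.scalar _ z + Ac) =
      (Matrix.scalar _ (-(z.im * z.im)) - A * A).map (algebraMap ℝ ℂ) := by
    have hcomm : Matrix.scalar _ z * Ac = Ac * Matrix.scalar _ z :=
      Matrix.scalar_commute z (fun r => mul_comm _ _) Ac
    have h1 : (Matrix.scalar _ (-(z.im * z.im)) - A * A).map (algebraMap ℝ ℂ) =
        Matrix.scalar _ (z * z) - Ac * Ac := by
      rw [hz2, Matrix.map_sub _ (map_sub _), Matrix.map_mul]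
      congr 1
      ext i j
      simp [Matrix.diagonal_apply]
      split_ifs <;> simp
    rw [h1, sub_mul, mul_add, mul_add, hcomm, ← map_mul]
    abel
  have hdet' : (Matrix.scalar _ (-(z.im * z.im)) - A * A).det = 0 := by
    have := congrArg Matrix.det hprod
    rw [Matrix.det_mul, hdet, zero_mul] at this
    have h2 := (RingHom.map_det (algebraMap ℝ ℂ)
      (Matrix.scalar _ (-(z.im * z.im)) - A * A))
    rw [RingHom.mapMatrix_apply, ← this] at h2
    simpa using h2
  have hmat : Matrix.scalar _ (-(z.im * z.im)) - A * A =
      LinearMap.toMatrix b b ((-(z.im * z.im)) • LinearMap.id - L ∘ₗ L) := by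
    rw [map_sub, LinearMap.toMatrix_comp b b b, map_smul, LinearMap.toMatrix_id]
    congr 1
    ext i j
    simp [Matrix.diagonal_apply, Matrix.one_apply]
  rw [hmat, LinearMap.det_toMatrix] at hdet'
  obtain ⟨y, hy, hy0⟩ := (Submodule.ne_bot_iff _).1 (LinearMap.bot_lt_ker_of_det_eq_zero hdet').ne'
  have hy' : L (L y) = (-(z.im * z.im)) • y :=
    (sub_eq_zero.1 (LinearMap.mem_ker.1 hy)).symm
  have h3 := hL y hy0
  rw [hy', show (-(z.im * z.im)) • y - y = (-(z.im * z.im) - 1) • y by module, norm_smul,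
    Real.norm_eq_abs, abs_of_neg (by nlinarith [mul_self_nonneg z.im])] at h3
  nlinarith [norm_nonneg y, mul_self_nonneg z.im, mul_nonneg (mul_self_nonneg z.im) (norm_nonneg y)]

variable {G : Type*} [Group G] [Fintype G]

/-- The basic neighbourhoods of the `C¹` topology. -/
theorem eventually_norm_sub_lt (v₀ : EquivariantVF G) (R : ℝ) {ε : ℝ} (hε : 0 < ε) :
    ∀ᶠ v in 𝓝 v₀, ∀ y ∈ closedBall (0 : G → ℂ) R, ‖v.toFun y - v₀.toFun y‖ < ε ∧
      ‖fderiv ℝ v.toFun y - fderiv ℝ v₀.toFun y‖ < ε := by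
  have hjet : Tendsto EquivariantVF.jet (𝓝 v₀) (𝓝 v₀.jet) :=
    (continuous_induced_dom (f := EquivariantVF.jet)).tendsto v₀
  have h1 := Metric.tendstoUniformlyOn_iff.1
    (ContinuousMap.tendsto_iff_forall_isCompact_tendstoUniformlyOn.1
    ((continuous_fst.tendsto _).comp hjet) _ (isCompact_closedBall (0 : G → ℂ) R)) ε hε
  have h2 := Metric.tendstoUniformlyOn_iff.1
    (ContinuousMap.tendsto_iff_forall_isCompact_tendstoUniformlyOn.1
    ((continuous_snd.tendsto _).comp hjet) _ (isCompact_closedBall (0 : G → ℂ) R)) ε hε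
  filter_upwards [h1, h2] with v hv1 hv2 y hy
  have a1 := hv1 y hy
  have a2 := hv2 y hy
  rw [dist_comm, dist_eq_norm] at a1 a2
  exact ⟨a1, a2⟩

theorem norm_sub_sub_sub_le {v v₀ : EquivariantVF G} {R ε : ℝ}
    (h : ∀ y ∈ closedBall (0 : G → ℂ) R, ‖fderiv ℝ v.toFun y - fderiv ℝ v₀.toFun y‖ ≤ ε)
    {y z : G → ℂ} (hy : y ∈ closedBall (0 : G → ℂ) R) (hz : z ∈ closedBall (0 : G → ℂ) R) :
    ‖(v.toFun y - v₀.toFun y) - (v.toFun z - v₀.toFun z)‖ ≤ ε * ‖y - z‖ := by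
  have hd := v.contDiff.differentiable one_ne_zero
  have hd₀ := v₀.contDiff.differentiable one_ne_zero
  refine (convex_closedBall (0 : G → ℂ) R).norm_image_sub_le_of_norm_hasFDerivWithin_le
    (f := fun y => v.toFun y - v₀.toFun y)
    (fun y _ => ((hd y).hasFDerivAt.sub (hd₀ y).hasFDerivAt).hasFDerivWithinAt) h hz hy

theorem EquivariantVF.mem_fixedSpace (v : EquivariantVF G) {S : Subgroup G} {y : G → ℂ}
    (hy : y ∈ fixedSpace S) : v.toFun y ∈ fixedSpace S := fun a ha => by
  rw [← v.equivariant, hy a ha]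

/-- The equilibrium persists in the space of points fixed by its isotropy group. -/
theorem exists_equilibrium {S H : Subgroup G} (hSH : S ≤ H) {v v₀ : EquivariantVF G} {R ε : ℝ}
    (hR : closedBall (basePoint H) (1 / 16) ⊆ closedBall 0 R)
    (hv₀ : ∀ y ∈ closedBall (basePoint H) (1 / 16), v₀.toFun y = saddle S (y - basePoint H))
    (hε : 0 < ε) (hε' : ε ≤ 1 / 32)
    (h0 : ∀ y ∈ closedBall (0 : G → ℂ) R, ‖v.toFun y - v₀.toFun y‖ ≤ ε)
    (h1 : ∀ y ∈ closedBall (0 : G → ℂ) R, ‖fderiv ℝ v.toFun y - fderiv ℝ v₀.toFun y‖ ≤ ε) :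
    ∃ x ∈ fixedSpace H, v.toFun x = 0 ∧ ‖x - basePoint H‖ ≤ 2 * ε := by
  let s : Set (G → ℂ) := closedBall (basePoint H) (2 * ε) ∩ fixedSpace H
  have hxH : basePoint H ∈ fixedSpace H := fun a ha => regRep_basePoint ha
  have hs : s ⊆ closedBall (basePoint H) (1 / 16) := fun y hy =>
    closedBall_subset_closedBall (by linarith) hy.1
  -- On Fix(H), contained in Fix(S), the model field is `-(y - x₀)`. Hence `y ↦ y + v y` is constant
  -- up to a small Lipschitz error.
  have hval : ∀ y ∈ s, y + v.toFun y = basePoint H + (v.toFun y - v₀.toFun y) := fun y hy => by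
    have hfix : y - basePoint H ∈ fixedSpace S := fun a ha => sub_mem hy.2 hxH a (hSH ha)
    rw [hv₀ y (hs hy), saddle_of_mem_fixedSpace hfix]
    abel
  have hbase : basePoint H ∈ s := ⟨mem_closedBall_self (by linarith), hxH⟩
  have hmaps : MapsTo (fun y => y + v.toFun y) s s := fun y hy => by
    refine ⟨?_, add_mem hy.2 (v.mem_fixedSpace hy.2)⟩
    show y + v.toFun y ∈ _
    rw [hval y hy, mem_closedBall, dist_eq_norm, add_sub_cancel_left]
    exact (h0 y (hR (hs hy))).trans (by linarith)
  have hcontr : ContractingWith (1 / 2 : ℝ≥0) (hmaps.restrict _ s s) := by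
    refine ⟨by norm_num, LipschitzWith.of_dist_le_mul fun y z => ?_⟩
    rw [Subtype.dist_eq, Subtype.dist_eq, MapsTo.val_restrict_apply, MapsTo.val_restrict_apply,
      hval y y.2, hval z z.2, dist_eq_norm, dist_eq_norm, add_sub_add_left_eq_sub]
    refine (norm_sub_sub_sub_le h1 (hR (hs y.2)) (hR (hs z.2))).trans ?_
    gcongr
    push_cast
    linarith
  obtain ⟨x, hx, hfix, -⟩ := hcontr.exists_fixedPoint'
    (isClosed_closedBall.inter (isClosed_fixedSpace H)).isComplete hmaps hbase (edist_ne_top _ _)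
  exact ⟨x, hx.2, by simpa [Function.IsFixedPt] using hfix, by simpa [dist_eq_norm] using hx.1⟩

end Perturbation

/-! ### Isotropy along trajectories and assembly. -/

section Main

open Set Metric
open scoped NNReal

variable {G : Type*} [Group G] [Fintype G] {K H : Subgroup G} {g : G}

/-- The restriction of an equivariant vector field to the space of points fixed by `S`. -/
def EquivariantVF.restrict (v : EquivariantVF G) (S : Subgroup G) (y : fixedSpace S) :
    fixedSpace S := ⟨v.toFun y, v.mem_fixedSpace y.2⟩

theorem EquivariantVF.contDiff_restrict (v : EquivariantVF G) (S : Subgroup G) :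
    ContDiff ℝ 1 (v.restrict S) := by
  obtain ⟨π, hπ⟩ := LinearMap.exists_leftInverse_of_injective (fixedSpace S).subtype
    (Submodule.ker_subtype _)
  have h : v.restrict S = fun y => π.toContinuousLinearMap (v.toFun ((fixedSpace S).subtypeL y)) := by
    funext y
    exact (LinearMap.congr_fun hπ (v.restrict S y)).symm
  rw [h]
  exact π.toContinuousLinearMap.contDiff.comp (v.contDiff.comp (fixedSpace S).subtypeL.contDiff)

/-- With `A = saddle S` and `A² = 1`, write `L² - 1 = (L - A) L + A (L - A)`, so `L²` stays close to
the identity. -/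
theorem isHyperbolicEquilibrium_of_norm_sub_le {S : Subgroup G} {v : EquivariantVF G}
    {x : G → ℂ} {ε : ℝ} (hx : v.toFun x = 0) (hε1 : ε ≤ 1)
    (hε : (2 * ‖saddle S‖ + 1) * ε < 1) (h : ‖fderiv ℝ v.toFun x - saddle S‖ ≤ ε) :
    IsHyperbolicEquilibrium v x := by
  refine ⟨hx, fun z hz => re_ne_zero_of_aeval_charpoly (fun y hy => ?_) hz⟩
  set L := fderiv ℝ v.toFun x
  have hε0 : 0 ≤ ε := (norm_nonneg _).trans h
  have hd : ∀ y, ‖L y - saddle S y‖ ≤ ε * ‖y‖ := fun y =>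
    ((L - saddle S).le_opNorm y).trans (by gcongr)
  have hLy : ‖L y‖ ≤ (‖saddle S‖ + 1) * ‖y‖ := by
    calc ‖L y‖ = ‖saddle S y + (L y - saddle S y)‖ := by congr 1; abel
      _ ≤ ‖saddle S‖ * ‖y‖ + ε * ‖y‖ :=
        (norm_add_le _ _).trans (add_le_add ((saddle S).le_opNorm y) (hd y))
      _ ≤ _ := by nlinarith [norm_nonneg y]
  calc ‖L (L y) - y‖ = ‖(L (L y) - saddle S (L y)) + saddle S (L y - saddle S y)‖ := by
        rw [map_sub, saddle_saddle]; congr 1; abel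
    _ ≤ ε * ((‖saddle S‖ + 1) * ‖y‖) + ‖saddle S‖ * (ε * ‖y‖) := by
        refine (norm_add_le _ _).trans (add_le_add ((hd _).trans (by gcongr)) ?_)
        exact ((saddle S).le_opNorm _).trans (by gcongr; exact hd y)
    _ = ((2 * ‖saddle S‖ + 1) * ε) * ‖y‖ := by ring
    _ < ‖y‖ := by nlinarith [norm_pos_iff.2 hy]

/-- If `a` fixes `γ t`, then `a · γ` and `γ` are trajectories through the same point, hence equal.
-/
theorem isotropy_le_of_trajectory {v : EquivariantVF G} {γ : ℝ → G → ℂ}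
    (hγ : ∀ t, HasDerivAt γ (v.toFun (γ t)) t) (t s : ℝ) : isotropy (γ t) ≤ isotropy (γ s) := by
  intro a ha
  have hρ : ∀ t, HasDerivAt (fun t => regRep G a (γ t)) (v.toFun (regRep G a (γ t))) t := fun t => by
    rw [v.equivariant]
    exact ((regRep G a).restrictScalars ℝ).toContinuousLinearMap.hasFDerivAt.comp_hasDerivAt t (hγ t)
  exact congrFun (trajectory_unique v.contDiff hρ hγ (t₀ := t) ha) s

/-- Otherwise a conjugate of `H` lies in `K ≤ H`, so `K = H` by counting. But `H` contains `S`,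
which is not inside `K`. -/
theorem notMem_orbit_of_isotropy (hT : IsHomoclinicTriple K g H) {x y : G → ℂ}
    (hx : isotropy x = H) (hy : isotropy y = K) : y ∉ orbit x := by
  rintro ⟨a, ha⟩
  change regRep G a x = y at ha
  have hle : ∀ h ∈ H, a * h * a⁻¹ ∈ K := fun h hh => by
    rw [← hx, mem_isotropy] at hh
    rw [← hy, mem_isotropy, ← ha, ← regRep_mul_apply, inv_mul_cancel_right, regRep_mul_apply, hh]
  have hcard : Nat.card H ≤ Nat.card K :=
    Nat.card_le_card_of_injective (fun h : H => (⟨a * h * a⁻¹, hle h h.2⟩ : K)) fun h₁ h₂ h =>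
      Subtype.ext (mul_left_cancel (mul_right_cancel (congrArg Subtype.val h)))
  have hKH : K ≤ H := fun k hk => (hT.ht2 hk).1
  obtain ⟨b, hb, hbK⟩ := exists_mem_conj_notMem hT
  exact hbK (Subgroup.eq_of_le_of_card_ge hKH hcard ▸ conj_inv_le hT hb)

theorem exists_forall_isotropy_le (K : Subgroup G) {y : G → ℂ} (hy : isotropy y ≤ K) :
    ∃ η > 0, ∀ z, ‖z - y‖ ≤ η → isotropy z ≤ K := by
  have hopen : IsOpen {z : G → ℂ | ∀ a : G, a ∉ K → regRep G a z ≠ z} := by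
    simp only [ofPred_forall]
    exact isOpen_iInter_of_finite fun a => isOpen_iInter_of_finite fun _ =>
      isOpen_ne_fun (continuous_regRep a) continuous_id
  obtain ⟨η, hη, hsub⟩ := nhds_basis_closedBall.mem_iff.1
    (hopen.mem_nhds (show y ∈ _ from fun a ha h => ha (hy h)))
  refine ⟨η, hη, fun z hz a ha => ?_⟩
  by_contra haK
  exact hsub (by rwa [mem_closedBall, dist_eq_norm]) a haK ha

/-- Distinct translates of the indicator of `H` are at distance at least `1`, so a small
perturbation gains no symmetry. -/
theorem isotropy_eq_of_norm_sub_lt {x : G → ℂ} (hx : x ∈ fixedSpace H)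
    (h : ‖x - basePoint H‖ < 1 / 2) : isotropy x = H := by
  refine le_antisymm (fun a ha => mem_of_norm_regRep_basePoint_sub_lt ?_) hx
  calc ‖regRep G a (basePoint H) - basePoint H‖ =
      ‖(x - basePoint H) - regRep G a (x - basePoint H)‖ := by
        rw [map_sub, mem_isotropy.1 ha]; congr 1; abel
    _ ≤ ‖x - basePoint H‖ + ‖x - basePoint H‖ := by
        conv_rhs => rw [← norm_regRep a (x - basePoint H)]
        conv_rhs => arg 1; rw [norm_regRep a (x - basePoint H)]
        exact norm_sub_le _ _
    _ < 1 := by linarith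

theorem EquivariantVF.eq_neg_of_mem_fixedSpace {v : EquivariantVF G}
    (hT : IsHomoclinicTriple K g H)
    (hv : ∀ y ∈ closedBall (basePoint H) (1 / 16),
      v.toFun y = saddle (conj K g⁻¹) (y - basePoint H)) {y : G → ℂ} (hy : y ∈ fixedSpace K)
    (hyg : y ∈ closedBall (regRep G g (basePoint H)) (1 / 16)) :
    v.toFun y = -(y - regRep G g (basePoint H)) := by
  have hmem : regRep G g⁻¹ y ∈ closedBall (basePoint H) (1 / 16) := by
    rw [mem_closedBall, dist_eq_norm] at hyg ⊢
    rwa [← norm_regRep g, map_sub, regRep_self_inv]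
  have h1 := hv _ hmem
  rw [v.equivariant] at h1
  rw [← regRep_self_inv g (v.toFun y), h1,
    ← regRep_saddle_of_mem_fixedSpace (g := g) (sub_mem hy (regRep_basePoint_mem_fixedSpace hT)),
    map_sub (regRep G g⁻¹), regRep_inv_self]

theorem exists_eventually_hasRHT (hT : IsHomoclinicTriple K g H) (hL : HTL K g H) :
    ∃ v₀ : EquivariantVF G, ContDiff ℝ ∞ v₀.toFun ∧ ∀ᶠ v in 𝓝 v₀, HasRHT v K g H := by
  obtain ⟨ξ, hξ1, hξ0, hξK, hξ⟩ := exists_profile hT hL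
  obtain ⟨v₀, hsmooth, hsaddle, hcurve⟩ := exists_equivariantVF hT hL hξ1 hξ0 hξK hξ
  refine ⟨v₀, hsmooth, ?_⟩
  set S := conj K g⁻¹
  set x₀ := basePoint H
  set q₀ := regRep G g x₀
  have hcont : Continuous (curve H g ξ) := continuous_curve
  have hx₀ : x₀ ∈ fixedSpace K := basePoint_mem_fixedSpace hT
  have hq₀ : q₀ ∈ fixedSpace K := regRep_basePoint_mem_fixedSpace hT
  have hKH : K ≤ H := fun k hk => (hT.ht2 hk).1
  -- a ball that contains the curve
  obtain ⟨C, hC⟩ := (isCompact_Icc (a := (0 : ℝ)) (b := 1)).exists_bound_of_continuousOn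
    hcont.continuousOn
  set R := C + 1
  have hball : ∀ y : G → ℂ, ‖y‖ ≤ C → closedBall y (1 / 16) ⊆ closedBall 0 R := fun y hy =>
    closedBall_subset_closedBall' (by simp only [dist_zero_right, R]; linarith)
  have hx₀C : ‖x₀‖ ≤ C := by simpa [curve_zero] using hC 0 (by simp)
  have hq₀C : ‖q₀‖ ≤ C := by simpa [curve_one] using hC 1 (by simp)
  -- the segment of the trajectory of `v₀`
  obtain ⟨τ₀, hτ₀, hτ₀', hξr⟩ : ∃ τ₀ : ℝ, 0 < τ₀ ∧ τ₀ < 1 / 2 ∧ ‖τ₀ • imagDir ξ‖ < 1 / 16 / 4 := by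
    have h : Tendsto (fun τ : ℝ => ‖τ • imagDir ξ‖) (𝓝[>] 0) (𝓝 0) := by
      have : Tendsto (fun τ : ℝ => ‖τ • imagDir ξ‖) (𝓝 0) (𝓝 ‖(0 : ℝ) • imagDir ξ‖) :=
        (Continuous.tendsto (by fun_prop) 0)
      rw [zero_smul, norm_zero] at this
      exact this.mono_left nhdsWithin_le_nhds
    obtain ⟨τ, h1, h2, h3⟩ := ((eventually_mem_nhdsWithin (a := (0 : ℝ)) (s := Ioi 0)).and
      (((eventually_lt_nhds (show (0 : ℝ) < 1 / 2 by norm_num)).filter_mono nhdsWithin_le_nhds).and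
      (h.eventually_lt_const (show (0 : ℝ) < 1 / 16 / 4 by norm_num)))).exists
    exact ⟨τ, h1, h2, h3⟩
  obtain ⟨τ₁, hτ₁, hτ₁', hζq⟩ : ∃ τ₁ : ℝ, 1 / 2 < τ₁ ∧ τ₁ < 1 ∧
      ‖curve H g ξ τ₁ - q₀‖ < 1 / 16 / 4 := by
    have h : Tendsto (fun τ : ℝ => ‖curve H g ξ τ - q₀‖) (𝓝[<] 1) (𝓝 0) := by
      have : Tendsto (fun τ : ℝ => ‖curve H g ξ τ - q₀‖) (𝓝 1) (𝓝 ‖curve H g ξ 1 - q₀‖) :=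
        (Continuous.tendsto (by fun_prop) 1)
      rw [curve_one, sub_self, norm_zero] at this
      exact this.mono_left nhdsWithin_le_nhds
    obtain ⟨τ, h1, h2, h3⟩ := ((eventually_mem_nhdsWithin (a := (1 : ℝ)) (s := Iio 1)).and
      (((eventually_gt_nhds (show (1 / 2 : ℝ) < 1 by norm_num)).filter_mono
        nhdsWithin_le_nhds).and
      (h.eventually_lt_const (show (0 : ℝ) < 1 / 16 / 4 by norm_num)))).exists
    exact ⟨τ, h2, h1, h3⟩
  obtain ⟨T, θ, hT0, hθ0, hθT, hθ⟩ := exists_speed_trajectory hτ₀ (hτ₀'.trans hτ₁).le hτ₁'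
  have hθI : ∀ t ∈ Icc 0 T, θ t ∈ Icc (0 : ℝ) 1 := fun t ht =>
    ⟨hτ₀.le.trans (hθ t ht).1.1, (hθ t ht).1.2.trans hτ₁'.le⟩
  let ζ : ℝ → fixedSpace K := fun t => ⟨curve H g ξ (θ t), curve_mem_fixedSpace hT hξK _⟩
  have hζ : ∀ t ∈ Icc 0 T, HasDerivAt ζ (v₀.restrict K (ζ t)) t := fun t ht => by
    have h1 : HasDerivAt (fun t => curve H g ξ (θ t)) (v₀.toFun (curve H g ξ (θ t))) t := by
      rw [hcurve _ (hθI t ht)]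
      exact (hasDerivAt_curve (H := H) (g := g) (ξ := ξ) (θ t)).scomp t (hθ t ht).2
    exact hasDerivAt_iff_tendsto_slope.2 (by
      rw [tendsto_subtype_rng]
      exact hasDerivAt_iff_tendsto_slope.1 h1)
  -- isotropy near the start of the segment
  have hiso : isotropy (ζ 0 : G → ℂ) ≤ K := fun a ha => by
    have h := mem_isotropy.1 ha
    change regRep G a (curve H g ξ (θ 0)) = curve H g ξ (θ 0) at h
    rw [hθ0] at h
    exact mem_of_regRep_curve_eq hξ1 hξ0 ⟨hτ₀, by linarith⟩ ⟨hτ₀.le, by linarith⟩ h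
  obtain ⟨η, hη, hηK⟩ := exists_forall_isotropy_le K hiso
  -- the unstable projection on the fixed space
  have hKn : ∀ k ∈ K, k ∈ Subgroup.normalizer (S : Set G) := fun k hk => (hL (hKH hk)).2
  have hPmem : ∀ y ∈ fixedSpace K, projUnstable S y ∈ fixedSpace K := fun y hy a ha => by
    rw [← projUnstable_regRep (hKn a ha), hy a ha]
  let P : fixedSpace K →L[ℝ] fixedSpace K :=
    ((projUnstable S).comp (fixedSpace K).subtypeL).codRestrict (fixedSpace K)
      fun y => hPmem y y.2
  obtain ⟨u', Ku, -, hKu, -, hu'⟩ := exists_lipschitzWith_eqOn_closedBall (v₀.contDiff_restrict K) R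
  have himag : imagDir ξ ∈ fixedSpace K := imagDir_mem_fixedSpace hξK
  obtain ⟨ε, hε, hmain⟩ := exists_heteroclinic (P := P) (u := v₀.restrict K) (K := Ku) (R := R)
    (r := 1 / 16) (T := T) (x := ⟨x₀, hx₀⟩) (q := ⟨q₀, hq₀⟩) (ξ := ⟨τ₀ • imagDir ξ,
      Submodule.smul_mem _ _ himag⟩) (ζ := ζ)
    (fun y => Subtype.ext (projUnstable_projUnstable _)) (by norm_num) hT0
    (fun y hy z hz => by rw [← hu' hy, ← hu' hz]; exact hKu y z)
    (fun y hy => Subtype.ext (hsaddle y hy))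
    (fun y hy => Subtype.ext (EquivariantVF.eq_neg_of_mem_fixedSpace hT hsaddle y.2 hy))
    (fun y hy => hball x₀ hx₀C hy) (fun y hy => hball q₀ hq₀C hy) hζ
    (fun t ht y hy => hball _ (hC _ (hθI t ht)) hy)
    (Subtype.ext (by
      show curve H g ξ (θ 0) = x₀ + τ₀ • imagDir ξ
      rw [hθ0, ← curve_sub_of_le hτ₀'.le]
      abel))
    (Subtype.ext (by
      show projUnstable S (τ₀ • imagDir ξ) = τ₀ • imagDir ξ
      rw [map_smul, projUnstable_apply, average_imagDir hξ, sub_zero]))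
    hξr.le (by
      show ‖curve H g ξ (θ T) - q₀‖ ≤ _
      rw [hθT]
      exact hζq.le) hη
  -- smallness
  obtain ⟨δ, hδ, h1, h2, h3⟩ : ∃ δ : ℝ, 0 < δ ∧ δ ≤ 1 / 33 ∧ 2 * δ ≤ ε ∧
      (2 * ‖saddle S‖ + 1) * δ < 1 := by
    have hpos : 0 < 2 * ‖saddle S‖ + 1 := by positivity
    -- With `1 / 33` the equilibrium, displaced by at most `2 / 33 < 1 / 16`, lies in the open ball
    -- where `v₀` is affine, so the derivative of `v₀` there is exactly `saddle S`.
    refine ⟨min (1 / 33) (min (ε / 2) (1 / (2 * (2 * ‖saddle S‖ + 1)))), by positivity,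
      min_le_left _ _, ?_, ?_⟩
    · linarith [(min_le_right (1 / 33) (min (ε / 2) (1 / (2 * (2 * ‖saddle S‖ + 1))))).trans
        (min_le_left _ _)]
    · calc _ ≤ (2 * ‖saddle S‖ + 1) * (1 / (2 * (2 * ‖saddle S‖ + 1))) := by
            gcongr
            exact (min_le_right _ _).trans (min_le_right _ _)
        _ = 1 / 2 := by field_simp
        _ < 1 := by norm_num
  filter_upwards [eventually_norm_sub_lt v₀ R hδ] with v hv
  have hv0 : ∀ y ∈ closedBall (0 : G → ℂ) R, ‖v.toFun y - v₀.toFun y‖ ≤ δ := fun y hy =>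
    (hv y hy).1.le
  have hv1 : ∀ y ∈ closedBall (0 : G → ℂ) R, ‖fderiv ℝ v.toFun y - fderiv ℝ v₀.toFun y‖ ≤ δ :=
    fun y hy => (hv y hy).2.le
  obtain ⟨x, hxH, hvx, hxx⟩ := exists_equilibrium (conj_inv_le hT) (hball x₀ hx₀C) hsaddle hδ
    (by linarith) hv0 hv1
  have hxK : x ∈ fixedSpace K := fun a ha => hxH a (hKH ha)
  have hxiso : isotropy x = H := isotropy_eq_of_norm_sub_lt hxH (by linarith)
  have hqK : regRep G g x ∈ fixedSpace K := fun a ha => by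
    have h := mem_conj.1 (hT.ht2 ha).2
    rw [← regRep_mul_apply, show a * g = g * (g⁻¹ * a * g) by group, regRep_mul_apply, hxH _ h]
  obtain ⟨γ, hγ, hbot, htop, hγ0⟩ := hmain (v.restrict K) (v.contDiff_restrict K)
    (fun y hy => (hv0 y hy).trans (by linarith))
    (fun y hy z hz => (norm_sub_sub_sub_le hv1 hy hz).trans
      (mul_le_mul_of_nonneg_right (by linarith) (norm_nonneg _)))
    ⟨x, hxK⟩ ⟨regRep G g x, hqK⟩ (Subtype.ext hvx)
    (Subtype.ext (by
      show v.toFun (regRep G g x) = 0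
      rw [v.equivariant, hvx, map_zero]))
    (hxx.trans h2) (by
      show ‖regRep G g x - q₀‖ ≤ ε
      rw [← map_sub, norm_regRep]
      exact hxx.trans h2)
  have hγ' : ∀ t, HasDerivAt (fun t => (γ t : G → ℂ)) (v.toFun (γ t)) t := fun t =>
    (fixedSpace K).subtypeL.hasFDerivAt.comp_hasDerivAt t (hγ t)
  -- Closeness to `ζ 0` at time `0` bounds the isotropy above by `K`; lying in Fix(K) bounds it
  -- below.
  have hγK : ∀ t, isotropy (γ t : G → ℂ) = K := fun t =>
    le_antisymm ((isotropy_le_of_trajectory hγ' t 0).trans (hηK _ hγ0)) (γ t).2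
  have hbot' : Tendsto (fun t => (γ t : G → ℂ)) atBot (𝓝 x) :=
    (continuous_subtype_val.tendsto _).comp hbot
  have htop' : Tendsto (fun t => (γ t : G → ℂ)) atTop (𝓝 (regRep G g x)) :=
    (continuous_subtype_val.tendsto _).comp htop
  have hxball : x ∈ ball x₀ (1 / 16) := by
    rw [mem_ball, dist_eq_norm]; linarith
  have hfd : fderiv ℝ v₀.toFun x = saddle S := by
    have : v₀.toFun =ᶠ[𝓝 x] fun y => saddle S (y - x₀) := by
      filter_upwards [isOpen_ball.mem_nhds hxball] with y hy using hsaddle y (ball_subset_closedBall hy)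
    rw [this.fderiv_eq]
    exact ((saddle S).hasFDerivAt.comp x ((hasFDerivAt_id x).sub_const x₀)).fderiv
  have hhyp : IsHyperbolicEquilibrium v x :=
    isHyperbolicEquilibrium_of_norm_sub_le hvx (by linarith) h3
      (hfd ▸ hv1 x (hball x₀ hx₀C (ball_subset_closedBall hxball)))
  exact ⟨x, fun t => γ t, ⟨hhyp, hγ', fun t => notMem_orbit_of_isotropy hT hxiso (hγK t),
    hbot'.mono_right (nhds_le_nhdsSet ⟨1, by simp⟩), htop'.mono_right (nhds_le_nhdsSet ⟨g, rfl⟩)⟩,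
    hγK, hxiso, hbot', htop'⟩

end Main

end RelHom

/-- The set `U` is open among the equivariant vector fields of class `C¹`; it contains a `C^∞` field,
so its trace on the `C^r` fields is nonempty and open for every `1 ≤ r ≤ ∞`. -/
theorem mainTheorem6 {G : Type*} [Group G] [Fintype G] (K : Subgroup G) (g : G) (H : Subgroup G)
    (hT : RelHom.IsHomoclinicTriple K g H) (hL : RelHom.HTL K g H) :
    ∃ U : Set (RelHom.EquivariantVF G), IsOpen U ∧
      (∃ v ∈ U, ContDiff ℝ ∞ v.toFun) ∧
      ∀ v ∈ U, RelHom.HasRHT v K g H := by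
  obtain ⟨v₀, hsmooth, hv₀⟩ := RelHom.exists_eventually_hasRHT hT hL
  exact ⟨interior {v | RelHom.HasRHT v K g H}, isOpen_interior,
    ⟨v₀, mem_interior_iff_mem_nhds.2 hv₀, hsmooth⟩,
    fun v hv => interior_subset (s := {v | RelHom.HasRHT v K g H}) hv⟩
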